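/- Let $d,N,p\ge 1$ be integers and let $\sigma,a,c>0$ and $\alpha,\beta,\gamma\in(0,1]$ be constants. Let $X=\{X(x,t):(x,t)\in\mathbb R^d\times\mathbb R\}$ be a real-valued centered stationary Gaussian random field with $\mathbb E[X(x,t)X(y,s)]=C(x-y,t-s)$, where $$C(x,t)=\frac{\sigma^2}{(1+a|t|^{2\alpha})^{\beta N/2}}\exp\left(-\frac{c|x|^{2\gamma}}{(1+a|t|^{2\alpha})^{\beta\gamma}}\right)$$ and $|x|$ is the Euclidean norm (the model of interest has $N=d+1$). Let $\mathbf X(x,t)=(X_1(x,t),\dots,X_p(x,t))\in\mathbb R^p$, where $X_1,\dots,X_p$ are independent copies of $X$, and assume that $\mathbf X$ has almost surely continuous sample functions. Write $\dim$ for Hausdorff dimension and $\mathrm{Gr}\,\mathbf X([0,1]^{d+1})=\{(x,t,\mathbf X(x,t)):(x,t)\in[0,1]^{d+1}\}$. Then, with probability 1, $$\dim\mathbf X([0,1]^{d+1})=\min\left\{p,\ \frac d\gamma+\frac1\alpha\right\}.$$ If $0<\alpha\le\gamma<1$, then, with probability 1, $$\dim\mathrm{Gr}\,\mathbf X([0,1]^{d+1})=\begin{cases}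 d+1+(1-\alpha)p & \text{if } p<\frac1\alpha,\\ d+\frac\gamma\alpha+(1-\gamma)p & \text{if } \frac1\alpha\le p<\frac1\alpha+\frac d\gamma,\\ \frac1\alpha+\frac d\gamma & \text{if } p\ge\frac1\alpha+\frac d\gamma.\end{cases}$$ If $0<\gamma\le\alpha<1$, then, with probability 1, $$\dim\mathrm{Gr}\,\mathbf X([0,1]^{d+1})=\begin{cases} d+1+(1-\gamma)p & \text{if } p<\frac d\gamma,\\ \frac{d\alpha}{\gamma}+1+(1-\alpha)p & \text{if } \frac d\gamma\le p<\frac1\alpha+\frac d\gamma,\\ \frac1\alpha+\frac d\gamma & \text{if } p\ge\frac1\alpha+\frac d\gamma.\end{cases}$$ -/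

import Mathlib

open MeasureTheory ProbabilityTheory

noncomputable section

/-- The space-time parameter space `ℝ^d × ℝ`; a point is `(x, t)` with `x` in space (with the
Euclidean norm) and `t` in time. -/
abbrev SpaceTime (d : ℕ) : Type := EuclideanSpace ℝ (Fin d) × ℝ

/-- The cube `[0,1]^{d+1}` in `ℝ^d × ℝ`. -/
def unitCube (d : ℕ) : Set (SpaceTime d) :=
  {z | (∀ i, z.1 i ∈ Set.Icc (0 : ℝ) 1) ∧ z.2 ∈ Set.Icc (0 : ℝ) 1}

/-- Gneiting's space-time covariance function
`C(x,t) = σ² (1 + a|t|^{2α})^{-βN/2} exp(-c|x|^{2γ} / (1 + a|t|^{2α})^{βγ})`. -/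
def gneitingCov (d N : ℕ) (σ a c α β γ : ℝ) (x : EuclideanSpace ℝ (Fin d)) (t : ℝ) : ℝ :=
  σ ^ 2 / (1 + a * |t| ^ (2 * α)) ^ (β * N / 2) *
    Real.exp (-(c * ‖x‖ ^ (2 * γ) / (1 + a * |t| ^ (2 * α)) ^ (β * γ)))

/-- `X` is a real-valued centered stationary Gaussian random field on `ℝ^d × ℝ` with stationary
covariance function `C`, that is, `E[X(x,t) X(y,s)] = C(x - y, t - s)`. -/
structure IsCenteredStationaryGaussianField {d : ℕ} {Ω : Type*} [MeasurableSpace Ω]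
    (P : Measure Ω) (X : SpaceTime d → Ω → ℝ) (C : EuclideanSpace ℝ (Fin d) → ℝ → ℝ) : Prop where
  measurable : ∀ z, Measurable (X z)
  gaussian : IsGaussianProcess X P
  centered : ∀ z, ∫ ω, X z ω ∂P = 0
  covariance : ∀ z w, ∫ ω, X z ω * X w ω ∂P = C (z.1 - w.1) (z.2 - w.2)

/-- `Y 0, …, Y (p-1)` are independent copies of the random field `X`: each is a random field with
the same law as `X` (on the product σ-algebra, i.e. the same finite-dimensional distributions), and
they are independent as random fields. They may live on another probability space. -/
structure AreIndependentCopies {d p : ℕ} {Ω Ω' : Type*} [MeasurableSpace Ω] [MeasurableSpace Ω']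
    (P : Measure Ω) (X : SpaceTime d → Ω → ℝ)
    (P' : Measure Ω') (Y : Fin p → SpaceTime d → Ω' → ℝ) : Prop where
  measurable : ∀ i z, Measurable (Y i z)
  identDistrib : ∀ i, IdentDistrib (fun ω z => Y i z ω) (fun ω z => X z ω) P' P
  indep : iIndepFun (fun i ω z => Y i z ω) P'

/-- The sample function `z ↦ (Y_1(z), …, Y_p(z)) ∈ ℝ^p` at the outcome `ω`. -/
def samplePath {d p : ℕ} {Ω : Type*} (Y : Fin p → SpaceTime d → Ω → ℝ) (ω : Ω) :
    SpaceTime d → EuclideanSpace ℝ (Fin p) :=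
  fun z => WithLp.toLp 2 (fun i => Y i z ω)

/-- The graph `{(z, f(z)) : z ∈ S}` over `S`. The maximum metric that the product type carries is
bi-Lipschitz equivalent to the Euclidean one, so it gives the same Hausdorff dimension. -/
def graphOver {T E : Type*} (f : T → E) (S : Set T) : Set (T × E) :=
  (fun z => (z, f z)) '' S

end

/-! Only the variogram matters. On the cube, `V z w = E (X z - X w)²` is comparable to ‖x - y‖^(2γ)
+ |t - s|^(2α) (`gneitingCov_increment_le`, `le_gneitingCov_increment`), so a space step 2^(-n/γ) or
a time step 2^(-n/α) moves the field by about 2^(-n).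

Upper bounds count boxes. On grids of mesh 2^(-un) in space and 2^(-vn) in time with uγ ≥ 1 and vα ≥
1, chaining (`ae_approximation_rate`) bounds the oscillation over a cell by nearly 2^(-n). For 1 ≤ x
≤ min(u, v) the graph over a cell then needs about 2^((x-1)pn) sets of size 2^(-xn), so its
dimension is at most (ud + v + (x-1)p)/x (`ae_dimH_graph_le_of_exponents`). The image is a
projection of the graph and lies in ℝ^p.

Lower bounds come from the energy of the uniform measure carried to the graph or the image
(`le_dimH_of_energy_lt_top`). For a < p, E‖Y z - Y w‖^(-a) is at most a constant times V^(-a/2).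
Write a = a₁ + a₂, charge a₁ to space and a₂ to time, and charge further exponents b₁, b₂ to the
displacement of the parameter. The expected energy is finite when γa₁ + b₁ < d, αa₂ + b₂ < 1 and a₁
+ a₂ < p (`ae_energy_lt_top`), so the graph has dimension at least a₁ + a₂ + b₁ + b₂, even under
weak inequalities, by a limit.

The two bounds are dual linear programs: (u/x, v/x, (x-1)/x) is feasible for the dual of the
maximisation of a₁ + a₂ + b₁ + b₂. The cases of the theorem are the vertices at which both values
agree. -/

open Filter Topology
open scoped ENNReal NNReal

/-! ### Hausdorff dimension: energy criterion, coverings, limits of bounds. -/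

/-- If a finite nonzero measure pushed forward by `F` has finite `s`-energy, then every set that
contains the range of `F` has Hausdorff dimension at least `s`. -/
theorem le_dimH_of_energy_lt_top {S E : Type*} [MeasurableSpace S] [MetricSpace E]
    [MeasurableSpace E] [BorelSpace E] [SecondCountableTopology E] (m : Measure S)
    [IsFiniteMeasure m] (hm : m ≠ 0) {F : S → E} (hF : Measurable F) {s : ℝ} (hs : 0 < s)
    (henergy : ∫⁻ x, ∫⁻ y, edist (F x) (F y) ^ (-s) ∂m ∂m < ∞) {T : Set E}
    (hT : ∀ᵐ x ∂m, F x ∈ T) : ENNReal.ofReal s ≤ dimH T := by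
  set φ : S → ℝ≥0∞ := fun x => ∫⁻ y, edist (F x) (F y) ^ (-s) ∂m with hφ
  have hmeas : Measurable (fun q : S × S => edist (F q.1) (F q.2) ^ (-s)) := by fun_prop
  have hφm : Measurable φ := hmeas.lintegral_prod_right'
  have hfin : ∀ᵐ x ∂m, φ x < ∞ := ae_lt_top hφm henergy.ne
  obtain ⟨M, hM⟩ : ∃ M : ℕ, m {x | φ x ≤ (M : ℝ≥0∞)} ≠ 0 := by
    by_contra! hcon
    apply hm
    rw [← Measure.measure_univ_eq_zero]
    have h1 : m (⋃ M : ℕ, {x | φ x ≤ (M : ℝ≥0∞)}) = 0 := measure_iUnion_null hcon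
    have h2 : ∀ᵐ x ∂m, x ∈ ⋃ M : ℕ, {x | φ x ≤ (M : ℝ≥0∞)} := by
      filter_upwards [hfin] with x hx
      obtain ⟨n, hn⟩ := ENNReal.exists_nat_gt hx.ne
      exact Set.mem_iUnion.2 ⟨n, hn.le⟩
    have h3 : m Set.univ ≤ m (⋃ M : ℕ, {x | φ x ≤ (M : ℝ≥0∞)}) :=
      measure_mono_ae (h2.mono fun x hx _ => hx)
    exact le_antisymm (h3.trans h1.le) bot_le
  -- Frostman's argument: on a part of positive mass where the potential is bounded by `M`, the
  -- push-forward charges a set of diameter δ with at most a constant times δ^s.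
  set G : Set S := {x | φ x ≤ (M : ℝ≥0∞)} with hG
  have hGm : MeasurableSet G := measurableSet_le hφm measurable_const
  -- The added 1 makes `K` invertible even if `M = 0`.
  set K : ℝ≥0∞ := (M : ℝ≥0∞) + 1 with hK
  have hK0 : K ≠ 0 := by simp [hK]
  have hKt : K ≠ ∞ := by simp [hK]
  set ν : Measure E := K⁻¹ • (m.restrict G).map F with hν
  have hle : ν ≤ Measure.hausdorffMeasure s := by
    refine Measure.le_hausdorffMeasure s ν 1 one_pos fun U _ => ?_
    -- `U` is arbitrary; its closure is measurable and has the same diameter.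
    have hcl : MeasurableSet (F ⁻¹' closure U) := hF isClosed_closure.measurableSet
    have h1 : ν U ≤ K⁻¹ * m (F ⁻¹' closure U ∩ G) := by
      calc ν U ≤ ν (closure U) := measure_mono subset_closure
        _ = _ := by
          rw [hν, Measure.smul_apply, Measure.map_apply hF isClosed_closure.measurableSet,
            Measure.restrict_apply hcl, smul_eq_mul]
    refine h1.trans ?_
    rcases (F ⁻¹' closure U ∩ G).eq_empty_or_nonempty with he | ⟨x, hxU, hxG⟩
    · simp [he]
    have h2 : Metric.ediam U ^ (-s) * m (F ⁻¹' closure U) ≤ K := by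
      calc Metric.ediam U ^ (-s) * m (F ⁻¹' closure U)
          = ∫⁻ _ in F ⁻¹' closure U, Metric.ediam U ^ (-s) ∂m := by simp
        _ ≤ ∫⁻ y in F ⁻¹' closure U, edist (F x) (F y) ^ (-s) ∂m := by
            refine setLIntegral_mono' hcl fun y hy => ?_
            rw [ENNReal.rpow_neg, ENNReal.rpow_neg]
            refine ENNReal.inv_le_inv.2 (ENNReal.rpow_le_rpow ?_ hs.le)
            rw [← Metric.ediam_closure U]
            exact Metric.edist_le_ediam_of_mem hxU hy
        _ ≤ φ x := setLIntegral_le_lintegral _ _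
        _ ≤ M := hxG
        _ ≤ K := le_self_add
    have h3 : m (F ⁻¹' closure U) ≤ K * Metric.ediam U ^ s := by
      -- For diameter 0 the kernel is infinite, so a finite potential forces mass 0: the
      -- push-forward has no atoms on `G`.
      rcases eq_or_ne (Metric.ediam U) 0 with h0 | h0
      · rw [h0, ENNReal.zero_rpow_of_neg (by linarith)] at h2
        by_contra! hlt
        have : m (F ⁻¹' closure U) ≠ 0 := (bot_le.trans_lt hlt).ne'
        rw [ENNReal.top_mul this] at h2
        exact hKt (top_le_iff.1 h2)
      rcases eq_or_ne (Metric.ediam U) ∞ with ht | ht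
      · rw [ht, ENNReal.top_rpow_of_pos hs, ENNReal.mul_top hK0]; exact le_top
      rw [ENNReal.rpow_neg] at h2
      have hd0 : Metric.ediam U ^ s ≠ 0 := by simp [h0, ht]
      have hdt : Metric.ediam U ^ s ≠ ∞ := ENNReal.rpow_ne_top_of_nonneg hs.le ht
      calc m (F ⁻¹' closure U)
          = Metric.ediam U ^ s * ((Metric.ediam U ^ s)⁻¹ * m (F ⁻¹' closure U)) := by
            rw [← mul_assoc, ENNReal.mul_inv_cancel hd0 hdt, one_mul]
        _ ≤ Metric.ediam U ^ s * K := by gcongr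
        _ = _ := mul_comm _ _
    calc K⁻¹ * m (F ⁻¹' closure U ∩ G) ≤ K⁻¹ * (K * Metric.ediam U ^ s) := by
          gcongr; exact (measure_mono Set.inter_subset_left).trans h3
      _ = _ := by rw [← mul_assoc, ENNReal.inv_mul_cancel hK0 hKt, one_mul]
  have hpos : Measure.hausdorffMeasure s T ≠ 0 := by
    intro h0
    have h1 : ν T = 0 := le_antisymm ((hle T).trans h0.le) bot_le
    rw [hν, Measure.smul_apply, smul_eq_mul, mul_eq_zero] at h1
    rcases h1 with h1 | h1
    · exact hKt (ENNReal.inv_eq_zero.1 h1)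
    have h2 : (m.restrict G) (F ⁻¹' T) = 0 :=
      le_antisymm ((Measure.le_map_apply hF.aemeasurable T).trans h1.le) bot_le
    have h3 : (m.restrict G) Set.univ ≤ (m.restrict G) (F ⁻¹' T) :=
      measure_mono_ae ((ae_restrict_of_ae hT).mono fun x hx _ => hx)
    rw [h2, Measure.restrict_apply_univ] at h3
    exact hM (le_antisymm h3 bot_le)
  have : (Real.toNNReal s : ℝ) = s := Real.coe_toNNReal s hs.le
  have h := le_dimH_of_hausdorffMeasure_ne_zero (d := Real.toNNReal s) (s := T)
    (by rw [this]; exact hpos)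
  exact h

/-- A set that can be covered by `N n` sets of diameter at most `r n`, where `r n → 0` and
`N n * r n ^ s → 0`, has Hausdorff dimension at most `s`. -/
theorem dimH_le_of_covering {E : Type*} [MetricSpace E] {T : Set E} {s : ℝ} (hs : 0 ≤ s)
    {ι : ℕ → Type*} [∀ n, Fintype (ι n)] (t : ∀ n, ι n → Set E) (r : ℕ → ℝ)
    (hr : Tendsto r atTop (𝓝 0)) (hr0 : ∀ n, 0 ≤ r n)
    (ht : ∀ n i, ∀ x ∈ t n i, ∀ y ∈ t n i, dist x y ≤ r n) (hcover : ∀ n, T ⊆ ⋃ i, t n i)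
    (hsum : Tendsto (fun n => (Fintype.card (ι n) : ℝ) * r n ^ s) atTop (𝓝 0)) :
    dimH T ≤ ENNReal.ofReal s := by
  borelize E
  have hd : ∀ n i, Metric.ediam (t n i) ≤ ENNReal.ofReal (r n) := fun n i =>
    Metric.ediam_le fun x hx y hy => by
      rw [edist_dist]; exact ENNReal.ofReal_le_ofReal (ht n i x hx y hy)
  have h1 := Measure.hausdorffMeasure_le_liminf_sum s T (l := atTop)
    (fun n => ENNReal.ofReal (r n)) (by simpa using ENNReal.tendsto_ofReal hr) t
    (Eventually.of_forall hd) (Eventually.of_forall hcover)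
  have h2 : Tendsto (fun n => ENNReal.ofReal ((Fintype.card (ι n) : ℝ) * r n ^ s)) atTop
      (𝓝 0) := by simpa using ENNReal.tendsto_ofReal hsum
  have h3 : Tendsto (fun n => ∑ i, Metric.ediam (t n i) ^ s) atTop (𝓝 0) := by
    refine tendsto_of_tendsto_of_tendsto_of_le_of_le tendsto_const_nhds h2 (fun _ => bot_le)
      fun n => ?_
    calc ∑ i, Metric.ediam (t n i) ^ s ≤ ∑ _i : ι n, ENNReal.ofReal (r n) ^ s :=
          Finset.sum_le_sum fun i _ => ENNReal.rpow_le_rpow (hd n i) hs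
      _ = ENNReal.ofReal ((Fintype.card (ι n) : ℝ) * r n ^ s) := by
          rw [ENNReal.ofReal_mul (by positivity), ENNReal.ofReal_rpow_of_nonneg (hr0 n) hs]
          simp
  rw [h3.liminf_eq] at h1
  have h4 := dimH_le_of_hausdorffMeasure_ne_top (d := Real.toNNReal s) (s := T)
    (by rw [Real.coe_toNNReal s hs]; exact (h1.trans_lt (by simp)).ne)
  exact h4

/-- An almost sure upper bound by every `s > B` gives one by `B`. -/
theorem ae_le_ofReal_of_forall_gt {Ω : Type*} [MeasurableSpace Ω] {P : Measure Ω}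
    {f : Ω → ℝ≥0∞} {B : ℝ} (h : ∀ s > B, ∀ᵐ ω ∂P, f ω ≤ ENNReal.ofReal s) :
    ∀ᵐ ω ∂P, f ω ≤ ENNReal.ofReal B := by
  have h1 : ∀ᵐ ω ∂P, ∀ n : ℕ, f ω ≤ ENNReal.ofReal (B + 1 / ((n : ℝ) + 1)) :=
    ae_all_iff.2 fun n => h _ (by have : (0 : ℝ) < 1 / ((n : ℝ) + 1) := by positivity
                                  linarith)
  filter_upwards [h1] with ω hω
  have ht : Tendsto (fun n : ℕ => B + 1 / ((n : ℝ) + 1)) atTop (𝓝 B) := by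
    simpa using tendsto_const_nhds.add (tendsto_one_div_add_atTop_nhds_zero_nat (𝕜 := ℝ))
  exact ge_of_tendsto' (ENNReal.tendsto_ofReal ht) hω

/-- An almost sure lower bound by every `θ * B` with `θ < 1` gives one by `B`. -/
theorem ae_ofReal_le_of_forall_lt {Ω : Type*} [MeasurableSpace Ω] {P : Measure Ω}
    {f : Ω → ℝ≥0∞} {B : ℝ}
    (h : ∀ θ : ℝ, 0 < θ → θ < 1 → ∀ᵐ ω ∂P, ENNReal.ofReal (θ * B) ≤ f ω) :
    ∀ᵐ ω ∂P, ENNReal.ofReal B ≤ f ω := by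
  have h1 : ∀ᵐ ω ∂P, ∀ n : ℕ, ENNReal.ofReal ((1 - 1 / ((n : ℝ) + 2)) * B) ≤ f ω := by
    refine ae_all_iff.2 fun n => h _ ?_ ?_
    · have : 1 / ((n : ℝ) + 2) < 1 := by
        rw [div_lt_one (by positivity)]
        have : (0 : ℝ) ≤ n := by positivity
        linarith
      linarith
    · have : (0 : ℝ) < 1 / ((n : ℝ) + 2) := by positivity
      linarith
  filter_upwards [h1] with ω hω
  have h2 : Tendsto (fun n : ℕ => 1 / ((n : ℝ) + 2)) atTop (𝓝 0) := by
    have := (tendsto_add_atTop_iff_nat 1).2 (tendsto_one_div_add_atTop_nhds_zero_nat (𝕜 := ℝ))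
    refine this.congr fun n => ?_
    push_cast; ring
  have ht : Tendsto (fun n : ℕ => (1 - 1 / ((n : ℝ) + 2)) * B) atTop (𝓝 B) := by
    simpa using ((tendsto_const_nhds (x := (1 : ℝ))).sub h2).mul_const B
  exact le_of_tendsto' (ENNReal.tendsto_ofReal ht) hω

/-! ### Two-sided bounds for the variogram. -/

section Covariance

variable {d N : ℕ} {σ a c α β γ : ℝ}

theorem gneitingCov_zero (hα : 0 < α) (hγ : 0 < γ) :
    gneitingCov d N σ a c α β γ 0 0 = σ ^ 2 := by
  have h1 : (2 * α) ≠ 0 := by positivity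
  have h2 : (2 * γ) ≠ 0 := by positivity
  simp [gneitingCov, Real.zero_rpow h1, Real.zero_rpow h2]

theorem one_sub_rpow_neg_le {A m : ℝ} (hA : 1 ≤ A) (hm : 0 ≤ m) :
    1 - (A ^ m)⁻¹ ≤ m * (A - 1) := by
  have hA0 : 0 < A := by linarith
  rw [← Real.rpow_neg hA0.le, Real.rpow_def_of_pos hA0]
  have h1 := Real.add_one_le_exp (Real.log A * -m)
  have h2 := Real.log_le_sub_one_of_pos hA0
  nlinarith

/-- This is 1 + u ≤ e^u multiplied by e^(-u). For u in a bounded range it bounds 1 - e^(-u) below by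
a multiple of u. -/
theorem mul_exp_neg_le_one_sub_exp {u : ℝ} : u * Real.exp (-u) ≤ 1 - Real.exp (-u) := by
  have h1 := Real.add_one_le_exp u
  have h2 : Real.exp u * Real.exp (-u) = 1 := by rw [← Real.exp_add]; simp
  have h3 := Real.exp_pos (-u)
  nlinarith

/-- The variogram of the Gneiting covariance is at most of order `‖x‖ ^ 2γ + |t| ^ 2α`. -/
theorem gneitingCov_increment_le (hα : 0 < α) (hβ : 0 < β) (hγ : 0 < γ) (ha : 0 < a)
    (hc : 0 < c) :
    ∃ K : ℝ, 0 ≤ K ∧ ∀ (x : EuclideanSpace ℝ (Fin d)) (t : ℝ),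
      gneitingCov d N σ a c α β γ 0 0 - gneitingCov d N σ a c α β γ x t ≤
        K * (‖x‖ ^ (2 * γ) + |t| ^ (2 * α)) := by
  refine ⟨σ ^ 2 * (c + β * N / 2 * a), by positivity, fun x t => ?_⟩
  rw [gneitingCov_zero hα hγ, gneitingCov]
  set T := |t| ^ (2 * α)
  set H := ‖x‖ ^ (2 * γ)
  have hT : 0 ≤ T := by positivity
  have hH : 0 ≤ H := by positivity
  have hA : 1 ≤ 1 + a * T := by nlinarith [mul_nonneg ha.le hT]
  set B := ((1 + a * T) ^ (β * N / 2)) with hB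
  have hB1 : 1 ≤ B := Real.one_le_rpow hA (by positivity)
  have hD1 : 1 ≤ (1 + a * T) ^ (β * γ) := Real.one_le_rpow hA (by positivity)
  have h1 : 1 - B⁻¹ ≤ β * N / 2 * a * T := by
    have := one_sub_rpow_neg_le hA (m := β * N / 2) (by positivity)
    rw [hB]; linarith
  set e := Real.exp (-(c * H / (1 + a * T) ^ (β * γ))) with he
  have h2 : 1 - e ≤ c * H := by
    have := Real.add_one_le_exp (-(c * H / (1 + a * T) ^ (β * γ)))
    have h3 : c * H / (1 + a * T) ^ (β * γ) ≤ c * H := div_le_self (by positivity) hD1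
    linarith
  have he1 : e ≤ 1 := Real.exp_le_one_iff.2 (by
    have : 0 ≤ c * H / (1 + a * T) ^ (β * γ) := by positivity
    linarith)
  have hBi : B⁻¹ ≤ 1 := inv_le_one_of_one_le₀ hB1
  have hBi0 : 0 ≤ B⁻¹ := by positivity
  -- The defects of the two factors add up to at least the defect of the product; the difference is
  -- (1 - B⁻¹)(1 - e) ≥ 0.
  have h3 : 1 - B⁻¹ * e ≤ c * H + β * N / 2 * a * T := by
    nlinarith [mul_nonneg (sub_nonneg.2 hBi) (sub_nonneg.2 he1)]
  have h4 : c * H + β * N / 2 * a * T ≤ (c + β * N / 2 * a) * (H + T) := by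
    have : 0 ≤ c * T + β * N / 2 * a * H := by positivity
    nlinarith
  calc σ ^ 2 - σ ^ 2 / B * e = σ ^ 2 * (1 - B⁻¹ * e) := by rw [div_eq_mul_inv]; ring
    _ ≤ σ ^ 2 * ((c + β * N / 2 * a) * (H + T)) := by gcongr; linarith
    _ = _ := by ring

/-- On bounded sets the variogram of the Gneiting covariance is at least of order
`max (‖x‖ ^ 2γ) (|t| ^ 2α)`. -/
theorem le_gneitingCov_increment (hα : 0 < α) (hβ : 0 < β) (hγ : 0 < γ) (ha : 0 < a)
    (hc : 0 < c) (hσ : 0 < σ) (hN : 1 ≤ N) {R : ℝ} (hR : 0 ≤ R) :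
    ∃ k : ℝ, 0 < k ∧ ∀ (x : EuclideanSpace ℝ (Fin d)) (t : ℝ), ‖x‖ ≤ R → |t| ≤ 1 →
      k * ‖x‖ ^ (2 * γ) ≤
        gneitingCov d N σ a c α β γ 0 0 - gneitingCov d N σ a c α β γ x t ∧
      k * |t| ^ (2 * α) ≤
        gneitingCov d N σ a c α β γ 0 0 - gneitingCov d N σ a c α β γ x t := by
  have hN' : (1 : ℝ) ≤ N := by exact_mod_cast hN
  set m := β * N / 2 with hm
  have hm0 : 0 < m := by positivity
  set W := c * R ^ (2 * γ) with hW
  have hW0 : 0 ≤ W := by positivity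
  -- Both constants come from u e^(-u) ≤ 1 - e^(-u): `k1` with u the exponent of the spatial factor,
  -- at most `W`, and `k2` with u = m log A, where a/(1+a)·T ≤ log A ≤ a.
  set k1 := c / (1 + a) ^ (β * γ) * Real.exp (-W) with hk1
  set k2 := m * (a / (1 + a)) * Real.exp (-(m * a)) with hk2
  have hk10 : 0 < k1 := by positivity
  have hk20 : 0 < k2 := by positivity
  refine ⟨σ ^ 2 * min k1 k2, by positivity, fun x t hx ht => ?_⟩
  rw [gneitingCov_zero hα hγ, gneitingCov, ← hm]
  have hT1 : |t| ^ (2 * α) ≤ 1 := Real.rpow_le_one (abs_nonneg t) ht (by positivity)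
  have hHR : ‖x‖ ^ (2 * γ) ≤ R ^ (2 * γ) :=
    Real.rpow_le_rpow (norm_nonneg x) hx (by positivity)
  set T := |t| ^ (2 * α)
  set H := ‖x‖ ^ (2 * γ)
  have hT : 0 ≤ T := by positivity
  have hH : 0 ≤ H := by positivity
  have hA : 1 ≤ 1 + a * T := by nlinarith [mul_nonneg ha.le hT]
  have hA2 : 1 + a * T ≤ 1 + a := by nlinarith
  set A := 1 + a * T with hAdef
  have hA0 : 0 < A := by linarith
  have hB1 : 1 ≤ A ^ m := Real.one_le_rpow hA hm0.le
  have hD1 : 1 ≤ A ^ (β * γ) := Real.one_le_rpow hA (by positivity)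
  have hD2 : A ^ (β * γ) ≤ (1 + a) ^ (β * γ) :=
    Real.rpow_le_rpow hA0.le hA2 (by positivity)
  have hlog1 : a / (1 + a) * T ≤ Real.log A := by
    have h := Real.one_sub_inv_le_log_of_pos hA0
    have h2 : 1 - A⁻¹ = a * T / A := by field_simp; rw [hAdef]; ring
    have h3 : a * T / (1 + a) ≤ a * T / A := by gcongr
    calc a / (1 + a) * T = a * T / (1 + a) := by ring
      _ ≤ _ := h3
      _ ≤ _ := by rw [← h2]; exact h
  have hlog2 : Real.log A ≤ a := by
    have := Real.log_le_sub_one_of_pos hA0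
    linarith
  set u := c * H / A ^ (β * γ) with hu
  have hu0 : 0 ≤ u := by positivity
  have huW : u ≤ W := (div_le_self (by positivity) hD1).trans (by rw [hW]; gcongr)
  have hu1 : c / (1 + a) ^ (β * γ) * H ≤ u := by
    calc c / (1 + a) ^ (β * γ) * H = c * H / (1 + a) ^ (β * γ) := by ring
      _ ≤ _ := by rw [hu]; gcongr
  have he : k1 * H ≤ 1 - Real.exp (-u) := by
    calc k1 * H = c / (1 + a) ^ (β * γ) * H * Real.exp (-W) := by rw [hk1]; ring
      _ ≤ u * Real.exp (-u) := by gcongr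
      _ ≤ _ := mul_exp_neg_le_one_sub_exp
  have hBe : (A ^ m)⁻¹ = Real.exp (-(m * Real.log A)) := by
    rw [← Real.rpow_neg hA0.le, Real.rpow_def_of_pos hA0]; ring_nf
  have hlog0 : 0 ≤ Real.log A := Real.log_nonneg hA
  have hb : k2 * T ≤ 1 - (A ^ m)⁻¹ := by
    rw [hBe]
    calc k2 * T = m * (a / (1 + a) * T) * Real.exp (-(m * a)) := by rw [hk2]; ring
      _ ≤ (m * Real.log A) * Real.exp (-(m * Real.log A)) := by gcongr
      _ ≤ _ := mul_exp_neg_le_one_sub_exp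
  have he1 : Real.exp (-u) ≤ 1 := Real.exp_le_one_iff.2 (by linarith)
  have he0 := (Real.exp_pos (-u)).le
  have hBi : (A ^ m)⁻¹ ≤ 1 := inv_le_one_of_one_le₀ hB1
  have hBi0 : 0 ≤ (A ^ m)⁻¹ := by positivity
  have hrw : σ ^ 2 - σ ^ 2 / A ^ m * Real.exp (-u) =
      σ ^ 2 * (1 - (A ^ m)⁻¹ * Real.exp (-u)) := by rw [div_eq_mul_inv]; ring
  rw [hrw, mul_assoc, mul_assoc]
  -- Both factors lie in [0, 1], so the defect of the product dominates the defect of each.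
  constructor
  · have : min k1 k2 * H ≤ k1 * H := by gcongr; exact min_le_left _ _
    gcongr
    nlinarith
  · have : min k1 k2 * T ≤ k2 * T := by gcongr; exact min_le_right _ _
    gcongr
    nlinarith

end Covariance

/-! ### Gaussian moments and singular integrals on the line. -/

section Gaussian

theorem gaussianReal_toNNReal_eq_map {v : ℝ} (hv : 0 ≤ v) :
    gaussianReal 0 v.toNNReal = (gaussianReal 0 1).map (Real.sqrt v * ·) := by
  rw [gaussianReal_map_const_mul]
  congr 1
  · simp
  · ext
    simp [Real.sq_sqrt hv, hv]

theorem lintegral_pow_gaussianReal {v : ℝ} (hv : 0 ≤ v) (q : ℕ) :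
    ∫⁻ x, ‖x‖ₑ ^ q ∂gaussianReal 0 v.toNNReal =
      ENNReal.ofReal (Real.sqrt v) ^ q * ∫⁻ x, ‖x‖ₑ ^ q ∂gaussianReal 0 1 := by
  rw [gaussianReal_toNNReal_eq_map hv, lintegral_map (by fun_prop) (by fun_prop),
    ← lintegral_const_mul _ (by fun_prop)]
  refine lintegral_congr fun x => ?_
  rw [enorm_mul, mul_pow, Real.enorm_of_nonneg (Real.sqrt_nonneg v)]

theorem lintegral_rpow_gaussianReal {v : ℝ} (hv : 0 < v) (e : ℝ) :
    ∫⁻ x, ‖x‖ₑ ^ e ∂gaussianReal 0 v.toNNReal =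
      ENNReal.ofReal (Real.sqrt v) ^ e * ∫⁻ x, ‖x‖ₑ ^ e ∂gaussianReal 0 1 := by
  rw [gaussianReal_toNNReal_eq_map hv.le, lintegral_map (by fun_prop) (by fun_prop),
    ← lintegral_const_mul _ (by fun_prop)]
  refine lintegral_congr fun x => ?_
  have h := Real.sqrt_pos.2 hv
  rw [enorm_mul, Real.enorm_of_nonneg h.le]
  exact ENNReal.mul_rpow_of_ne_top (by simp) (by simp) _

theorem lintegral_pow_gaussianReal_ne_top (q : ℕ) :
    ∫⁻ x, ‖x‖ₑ ^ q ∂gaussianReal 0 1 ≠ ∞ := by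
  have h := (memLp_id_gaussianReal (μ := 0) (v := 1) (q : ℝ≥0)).eLpNorm_ne_top
  rcases Nat.eq_zero_or_pos q with rfl | hq
  · simp
  have hq' : ((q : ℝ≥0) : ℝ≥0∞) ≠ 0 := by simpa using hq.ne'
  have h2 := lintegral_rpow_enorm_lt_top_of_eLpNorm_lt_top hq' (by simp) h.lt_top
  simpa using h2.ne

/-- The density is at most 1/√(2π) < 1. -/
theorem gaussianReal_le_volume : gaussianReal 0 1 ≤ (volume : Measure ℝ) := by
  rw [gaussianReal_of_var_ne_zero 0 one_ne_zero]
  calc volume.withDensity (gaussianPDF 0 1) ≤ (volume : Measure ℝ).withDensity 1 := by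
        refine withDensity_mono (Eventually.of_forall fun x => ?_)
        rw [gaussianPDF, Pi.one_apply, ← ENNReal.ofReal_one]
        apply ENNReal.ofReal_le_ofReal
        rw [gaussianPDFReal]
        have h1 : (1 : ℝ) ≤ Real.sqrt (2 * Real.pi * (1 : ℝ≥0)) := by
          rw [Real.one_le_sqrt]
          have := Real.pi_gt_three
          norm_num; linarith
        have h2 : Real.exp (-(x - 0) ^ 2 / (2 * (1 : ℝ≥0))) ≤ 1 := by
          apply Real.exp_le_one_iff.2
          have : 0 ≤ (x - 0) ^ 2 / (2 * ((1 : ℝ≥0) : ℝ)) := by positivity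
          rw [neg_div]; linarith
        exact mul_le_one₀ (inv_le_one_of_one_le₀ h1) (Real.exp_pos _).le h2
    _ = _ := withDensity_one

/-- The singular integral `∫ |x| ^ (-e)` over `[-1, 1]`. -/
noncomputable def singularIntegral (e : ℝ) : ℝ≥0∞ :=
  ∫⁻ x in Set.Icc (-1 : ℝ) 1, ‖x‖ₑ ^ (-e)

theorem singularIntegral_ne_top {e : ℝ} (he : e < 1) : singularIntegral e ≠ ∞ := by
  have h0 : ∫⁻ x in Set.Ioc (0 : ℝ) 1, ‖x‖ₑ ^ (-e) ≠ ∞ := by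
    have h := (intervalIntegrable_iff_integrableOn_Ioc_of_le zero_le_one).1
      (intervalIntegral.intervalIntegrable_rpow' (a := 0) (b := 1) (r := -e) (by linarith))
    have h2 := h.2
    rw [HasFiniteIntegral] at h2
    refine (lt_of_eq_of_lt ?_ h2).ne
    refine setLIntegral_congr_fun measurableSet_Ioc fun x hx => ?_
    rw [Real.enorm_of_nonneg hx.1.le, Real.enorm_of_nonneg (Real.rpow_nonneg hx.1.le _),
      ENNReal.ofReal_rpow_of_pos hx.1]
  have h1 : ∫⁻ x in Set.Ico (-1 : ℝ) 0, ‖x‖ₑ ^ (-e) = ∫⁻ x in Set.Ioc (0 : ℝ) 1, ‖x‖ₑ ^ (-e) := by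
    have := (Measure.measurePreserving_neg (volume : Measure ℝ)).setLIntegral_comp_preimage
      (s := Set.Ioc (0 : ℝ) 1) measurableSet_Ioc (f := fun x => ‖x‖ₑ ^ (-e)) (by fun_prop)
    rw [← this]
    simp
  have h2 : Set.Icc (-1 : ℝ) 1 ⊆ Set.Ico (-1 : ℝ) 0 ∪ ({0} ∪ Set.Ioc (0 : ℝ) 1) := by
    intro x hx
    rcases lt_trichotomy x 0 with h | h | h
    · exact Or.inl ⟨hx.1, h⟩
    · exact Or.inr (Or.inl h)
    · exact Or.inr (Or.inr ⟨h, hx.2⟩)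
  refine ne_top_of_le_ne_top ?_ ((lintegral_mono_set h2).trans ((lintegral_union_le _ _ _).trans
    (add_le_add_right (lintegral_union_le _ _ _) _)))
  rw [h1]
  simp [h0]

/-- Within distance 1 of `y` the measure is compared with Lebesgue measure; farther away the kernel
is at most 1. The domination hypothesis covers both the standard Gaussian law and the uniform law on
[0, 1]. -/
theorem lintegral_sub_rpow_neg_le {μ : Measure ℝ} [IsProbabilityMeasure μ]
    (hμ : μ ≤ volume) {e : ℝ} (he : 0 ≤ e) (y : ℝ) :
    ∫⁻ x, ‖y - x‖ₑ ^ (-e) ∂μ ≤ singularIntegral e + 1 := by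
  have hb : MeasurableSet (Set.Icc (y - 1) (y + 1)) := measurableSet_Icc
  rw [← lintegral_add_compl _ hb]
  refine add_le_add ?_ ?_
  · calc ∫⁻ x in Set.Icc (y - 1) (y + 1), ‖y - x‖ₑ ^ (-e) ∂μ
        ≤ ∫⁻ x in Set.Icc (y - 1) (y + 1), ‖y - x‖ₑ ^ (-e) :=
          lintegral_mono' (Measure.restrict_mono le_rfl hμ) le_rfl
      _ = singularIntegral e := by
          have := (Measure.measurePreserving_sub_left (volume : Measure ℝ) y).setLIntegral_comp_preimage
            (s := Set.Icc (-1 : ℝ) 1) measurableSet_Icc (f := fun x => ‖x‖ₑ ^ (-e)) (by fun_prop)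
          rw [singularIntegral, ← this]
          congr 2
          rw [Set.preimage_const_sub_Icc]; ring_nf
  · calc ∫⁻ x in (Set.Icc (y - 1) (y + 1))ᶜ, ‖y - x‖ₑ ^ (-e) ∂μ
        ≤ ∫⁻ x in (Set.Icc (y - 1) (y + 1))ᶜ, 1 ∂μ := by
          refine setLIntegral_mono' hb.compl fun x hx => ?_
          rw [ENNReal.rpow_neg]
          refine ENNReal.inv_le_one.2 ?_
          rw [← ENNReal.one_rpow e]
          refine ENNReal.rpow_le_rpow ?_ he
          rw [Real.enorm_eq_ofReal_abs, ENNReal.one_le_ofReal]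
          by_contra! hlt
          rw [abs_lt] at hlt
          exact hx ⟨by linarith, by linarith⟩
      _ ≤ 1 := by simpa using prob_le_one

theorem lintegral_rpow_neg_gaussianReal_ne_top {e : ℝ} (he0 : 0 ≤ e) (he : e < 1) :
    ∫⁻ x, ‖x‖ₑ ^ (-e) ∂gaussianReal 0 1 ≠ ∞ := by
  have h := lintegral_sub_rpow_neg_le gaussianReal_le_volume he0 0
  simp only [zero_sub, enorm_neg] at h
  exact ne_top_of_le_ne_top (by simp [singularIntegral_ne_top he]) h

end Gaussian

/-! ### Chaining for Gaussian increments. -/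

/-- A continuous random field with `p` components whose increments between two points `z`, `w` are
independent centered Gaussian variables of variance `V z w`. -/
structure HasIndepGaussianIncrements {T Ω : Type*} [TopologicalSpace T] [MeasurableSpace Ω]
    {p : ℕ} (P : Measure Ω) (Y : Fin p → T → Ω → ℝ) (V : T → T → ℝ) : Prop where
  measurable : ∀ i z, Measurable (Y i z)
  continuous : ∀ i ω, Continuous fun z => Y i z ω
  law : ∀ i z w, P.map (fun ω => Y i z ω - Y i w ω) = gaussianReal 0 (V z w).toNNReal
  indep : ∀ z w, iIndepFun (fun i ω => Y i z ω - Y i w ω) P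
  nonneg : ∀ z w, 0 ≤ V z w

/-- Chaining: along a sequence of finite grids of at most exponentially growing cardinality, on
which the increments between consecutive approximations have standard deviation `O(2 ^ (-n))`,
the sample functions are approximated at every geometric rate slower than `2 ^ (-n)`. -/
theorem ae_approximation_rate {T Ω : Type*} [TopologicalSpace T] [MeasurableSpace Ω]
    {P : Measure Ω} {X : T → Ω → ℝ} {V : T → T → ℝ} (hmeas : ∀ z, Measurable (X z))
    (hcont : ∀ ω, Continuous fun z => X z ω)
    (hlaw : ∀ z w, P.map (fun ω => X z ω - X w ω) = gaussianReal 0 (V z w).toNNReal)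
    (hV0 : ∀ z w, 0 ≤ V z w) {J : ℕ → Type*} [∀ n, Fintype (J n)] (g : ∀ n, J n → T)
    (idx : ∀ n, T → J n) {S : Set T}
    (hlim : ∀ z ∈ S, Tendsto (fun n => g n (idx n z)) atTop (𝓝 z)) {C B : ℝ} (hC : 0 ≤ C)
    (hB : 0 ≤ B) (hcard : ∀ n, (Fintype.card (J n) : ℝ) ≤ C * B ^ n)
    (hV : ∀ z ∈ S, ∀ n, V (g n (idx n z)) (g (n + 1) (idx (n + 1) z)) ≤ C * (1 / 4) ^ n)
    {r : ℝ} (hr : 1 / 2 < r) (hr1 : r < 1) :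
    ∀ᵐ ω ∂P, ∃ K : ℝ, 0 ≤ K ∧ ∀ z ∈ S, ∀ n, |X (g n (idx n z)) ω - X z ω| ≤ K * r ^ n := by
  classical
  have hr0 : 0 < r := by linarith
  -- There are O(B^(2n)) pairs of consecutive grid points, while the normalised moment of order q +
  -- 1 is O((2r)^(-n(q+1))); this `q` makes the product summable.
  obtain ⟨q, hq⟩ : ∃ q : ℕ, B * B < (2 * r) ^ q :=
    pow_unbounded_of_one_lt (B * B) (by linarith : 1 < 2 * r)
  -- These finitely many pairs do not depend on `z`, so one almost sure event serves all points of
  -- `S`.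
  set Q : ∀ n, Finset (J n × J (n + 1)) := fun n =>
    Finset.univ.filter fun j => V (g n j.1) (g (n + 1) j.2) ≤ C * (1 / 4) ^ n with hQ
  set Z : Ω → ℝ≥0∞ := fun ω => ∑' n : ℕ, ∑ j ∈ Q n,
    ENNReal.ofReal ((r⁻¹) ^ n) ^ (q + 1) * ‖X (g n j.1) ω - X (g (n + 1) j.2) ω‖ₑ ^ (q + 1) with hZ
  set m : ℝ≥0∞ := ∫⁻ x, ‖x‖ₑ ^ (q + 1) ∂gaussianReal 0 1 with hm
  have hmt : m ≠ ∞ := lintegral_pow_gaussianReal_ne_top (q + 1)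
  have hterm : ∀ n, ∀ j ∈ Q n, ∫⁻ ω, ENNReal.ofReal ((r⁻¹) ^ n) ^ (q + 1) *
      ‖X (g n j.1) ω - X (g (n + 1) j.2) ω‖ₑ ^ (q + 1) ∂P ≤
      ENNReal.ofReal ((Real.sqrt C * ((2 * r)⁻¹) ^ n) ^ (q + 1)) * m := by
    intro n j hj
    have hj' : V (g n j.1) (g (n + 1) j.2) ≤ C * (1 / 4) ^ n := (Finset.mem_filter.1 hj).2
    have hXm : Measurable fun ω => X (g n j.1) ω - X (g (n + 1) j.2) ω :=
      (hmeas _).sub (hmeas _)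
    rw [lintegral_const_mul _ (by fun_prop)]
    have h1 : ∫⁻ ω, ‖X (g n j.1) ω - X (g (n + 1) j.2) ω‖ₑ ^ (q + 1) ∂P =
        ENNReal.ofReal (Real.sqrt (V (g n j.1) (g (n + 1) j.2))) ^ (q + 1) * m := by
      rw [hm, ← lintegral_pow_gaussianReal (hV0 _ _), ← hlaw, lintegral_map (by fun_prop) hXm]
    have h2 : Real.sqrt (V (g n j.1) (g (n + 1) j.2)) ≤ Real.sqrt C * (1 / 2) ^ n := by
      rw [Real.sqrt_le_left (by positivity), mul_pow, Real.sq_sqrt hC, ← pow_mul, mul_comm n 2,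
        pow_mul]
      norm_num
      simpa using hj'
    rw [h1, ← mul_assoc, ← ENNReal.ofReal_pow (by positivity), ← ENNReal.ofReal_pow (by positivity),
      ← ENNReal.ofReal_mul (by positivity)]
    refine mul_le_mul' (ENNReal.ofReal_le_ofReal ?_) le_rfl
    rw [← mul_pow]
    refine pow_le_pow_left₀ (by positivity) ?_ _
    calc r⁻¹ ^ n * Real.sqrt (V (g n j.1) (g (n + 1) j.2))
        ≤ r⁻¹ ^ n * (Real.sqrt C * (1 / 2) ^ n) := by gcongr
      _ = Real.sqrt C * ((2 * r)⁻¹) ^ n := by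
        rw [mul_inv, mul_pow]; ring
  set ρ : ℝ := B * B * ((2 * r)⁻¹) ^ (q + 1) with hρ
  have hρ1 : ρ < 1 := by
    have h1 : 0 < (2 * r) ^ (q + 1) := by positivity
    have h2 : (2 * r) ^ q ≤ (2 * r) ^ (q + 1) := pow_le_pow_right₀ (by linarith) (by omega)
    rw [hρ, inv_pow, ← div_eq_mul_inv, div_lt_one h1]
    linarith
  have hρ0 : 0 ≤ ρ := by positivity
  have hsumn : ∀ n, ∫⁻ ω, ∑ j ∈ Q n, ENNReal.ofReal ((r⁻¹) ^ n) ^ (q + 1) *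
      ‖X (g n j.1) ω - X (g (n + 1) j.2) ω‖ₑ ^ (q + 1) ∂P ≤
      ENNReal.ofReal (C * C * B * (Real.sqrt C) ^ (q + 1) * ρ ^ n) * m := by
    intro n
    rw [lintegral_finsetSum _ fun j _ => by
      have h1 := hmeas (g n j.1)
      have h2 := hmeas (g (n + 1) j.2)
      fun_prop]
    refine (Finset.sum_le_sum (hterm n)).trans ?_
    rw [Finset.sum_const, nsmul_eq_mul, ← mul_assoc, ← ENNReal.ofReal_natCast,
      ← ENNReal.ofReal_mul (by positivity)]
    refine mul_le_mul' (ENNReal.ofReal_le_ofReal ?_) le_rfl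
    have hQc : ((Q n).card : ℝ) ≤ (C * B ^ n) * (C * B ^ (n + 1)) := by
      calc ((Q n).card : ℝ) ≤ (Fintype.card (J n × J (n + 1)) : ℝ) := by
            exact_mod_cast Finset.card_le_univ _
        _ = Fintype.card (J n) * Fintype.card (J (n + 1)) := by
            rw [Fintype.card_prod]; push_cast; ring
        _ ≤ _ := mul_le_mul (hcard n) (hcard (n + 1)) (by positivity) (by positivity)
    calc ((Q n).card : ℝ) * (Real.sqrt C * ((2 * r)⁻¹) ^ n) ^ (q + 1)
        ≤ (C * B ^ n) * (C * B ^ (n + 1)) * (Real.sqrt C * ((2 * r)⁻¹) ^ n) ^ (q + 1) := by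
          gcongr
      _ = C * C * B * (Real.sqrt C) ^ (q + 1) * ρ ^ n := by
          rw [hρ, mul_pow, mul_pow, mul_pow, ← pow_mul, ← pow_mul, mul_comm n (q + 1)]
          ring
  have hZm : AEMeasurable Z P := by
    refine Measurable.aemeasurable ?_
    refine Measurable.tsum fun n => Finset.measurable_fun_sum _ fun j _ => ?_
    have h1 := hmeas (g n j.1)
    have h2 := hmeas (g (n + 1) j.2)
    fun_prop
  have hZint : ∫⁻ ω, Z ω ∂P ≠ ∞ := by
    rw [hZ, lintegral_tsum fun n => ?_]
    · refine ne_top_of_le_ne_top ?_ (ENNReal.tsum_le_tsum hsumn)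
      rw [ENNReal.tsum_mul_right]
      refine ENNReal.mul_ne_top ?_ hmt
      exact ((summable_geometric_of_lt_one hρ0 hρ1).mul_left _).tsum_ofReal_ne_top
    · refine (Finset.measurable_fun_sum _ fun j _ => ?_).aemeasurable
      have h1 := hmeas (g n j.1)
      have h2 := hmeas (g (n + 1) j.2)
      fun_prop
  filter_upwards [ae_lt_top' hZm hZint] with ω hω
  -- The added 1 covers normalised increments below 1; those at least 1 are bounded by their
  -- (q+1)-th power, a term of `Z`.
  set K0 : ℝ := (Z ω).toReal + 1 with hK0
  have hK0' : 0 ≤ K0 := by positivity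
  have hstep : ∀ z ∈ S, ∀ n, dist (X (g n (idx n z)) ω) (X (g (n + 1) (idx (n + 1) z)) ω) ≤
      K0 * r ^ n := by
    intro z hz n
    set x := |X (g n (idx n z)) ω - X (g (n + 1) (idx (n + 1) z)) ω| with hx
    have hmem : (idx n z, idx (n + 1) z) ∈ Q n := Finset.mem_filter.2 ⟨Finset.mem_univ _, hV z hz n⟩
    have h1 : ENNReal.ofReal ((r⁻¹ ^ n * x) ^ (q + 1)) ≤ Z ω := by
      refine le_trans ?_ (ENNReal.le_tsum n)
      refine le_trans ?_ (Finset.single_le_sum (fun _ _ => zero_le) hmem)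
      rw [ENNReal.ofReal_pow (by positivity), ENNReal.ofReal_mul (by positivity), mul_pow,
        Real.enorm_eq_ofReal_abs]
    have h2 : (r⁻¹ ^ n * x) ^ (q + 1) ≤ (Z ω).toReal :=
      (ENNReal.ofReal_le_iff_le_toReal hω.ne).1 h1
    have h3 : r⁻¹ ^ n * x ≤ K0 := by
      by_contra! hlt
      have h4 : 1 ≤ r⁻¹ ^ n * x := by
        have : (0 : ℝ) ≤ (Z ω).toReal := ENNReal.toReal_nonneg
        linarith
      have h5 : r⁻¹ ^ n * x ≤ (r⁻¹ ^ n * x) ^ (q + 1) := le_self_pow₀ h4 (by omega)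
      linarith
    rw [Real.dist_eq]
    calc x = r⁻¹ ^ n * x * r ^ n := by
          rw [inv_pow]; field_simp
      _ ≤ K0 * r ^ n := by gcongr
  refine ⟨K0 / (1 - r), div_nonneg hK0' (by linarith), fun z hz n => ?_⟩
  -- Continuity identifies the limit of the chain, and the remaining geometric tail gives the rate.
  have hl : Tendsto (fun n => X (g n (idx n z)) ω) atTop (𝓝 (X z ω)) :=
    ((hcont ω).tendsto z).comp (hlim z hz)
  have := dist_le_of_le_geometric_of_tendsto r K0 hr1 (hstep z hz) hl n
  rw [Real.dist_eq] at this
  calc _ ≤ _ := this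
    _ = _ := by ring

/-! ### Grids, coverings of the graph and the upper bound. -/

section Grid

variable {d : ℕ}

/-- Indices of the grid of mesh `1 / A` in space and `1 / B` in time. -/
abbrev GridIndex (d : ℕ) (A B : ℝ) : Type :=
  (Fin d → Fin (⌊A⌋₊ + 1)) × Fin (⌊B⌋₊ + 1)

/-- The grid point with a given index. -/
noncomputable def gridPoint (A B : ℝ) (j : GridIndex d A B) : SpaceTime d :=
  (WithLp.toLp 2 fun i => (j.1 i : ℝ) / A, (j.2 : ℝ) / B)

/-- The index of the grid point just below a point of the cube. -/
noncomputable def gridFloor (A B : ℝ) (z : SpaceTime d) : GridIndex d A B :=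
  (fun i => ⟨min ⌊A * z.1 i⌋₊ ⌊A⌋₊, by omega⟩, ⟨min ⌊B * z.2⌋₊ ⌊B⌋₊, by omega⟩)

theorem card_gridIndex_le {A B : ℝ} (hA : 1 ≤ A) (hB : 1 ≤ B) :
    (Fintype.card (GridIndex d A B) : ℝ) ≤ (2 * A) ^ d * (2 * B) := by
  have h : ∀ x : ℝ, 1 ≤ x → ((⌊x⌋₊ + 1 : ℕ) : ℝ) ≤ 2 * x := fun x hx => by
    have := Nat.floor_le (by linarith : 0 ≤ x)
    push_cast; linarith
  rw [Fintype.card_prod, Fintype.card_fun, Fintype.card_fin, Fintype.card_fin, Fintype.card_fin]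
  rw [Nat.cast_mul, Nat.cast_pow]
  gcongr
  · exact h A hA
  · exact h B hB

theorem abs_floor_div_sub_le {A x : ℝ} (hA : 0 < A) (hx : x ∈ Set.Icc (0 : ℝ) 1) :
    |((min ⌊A * x⌋₊ ⌊A⌋₊ : ℕ) : ℝ) / A - x| ≤ 1 / A := by
  -- On [0, 1] the truncation in `gridFloor` is inactive.
  have h1 : ⌊A * x⌋₊ ≤ ⌊A⌋₊ := Nat.floor_mono (by nlinarith [hx.2])
  rw [min_eq_left h1]
  have h2 := Nat.floor_le (mul_nonneg hA.le hx.1)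
  have h3 := Nat.lt_floor_add_one (A * x)
  have h4 : (⌊A * x⌋₊ : ℝ) / A - x = ((⌊A * x⌋₊ : ℝ) - A * x) / A := by field_simp
  rw [h4, abs_div, abs_of_pos hA]
  gcongr
  rw [abs_le]; constructor <;> linarith

theorem abs_gridPoint_fst_sub_le {A B : ℝ} (hA : 0 < A) {z : SpaceTime d} (hz : z ∈ unitCube d)
    (i : Fin d) : |(gridPoint A B (gridFloor A B z)).1 i - z.1 i| ≤ 1 / A :=
  abs_floor_div_sub_le hA (hz.1 i)

theorem abs_gridPoint_snd_sub_le {A B : ℝ} (hB : 0 < B) {z : SpaceTime d} (hz : z ∈ unitCube d) :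
    |(gridPoint A B (gridFloor A B z)).2 - z.2| ≤ 1 / B :=
  abs_floor_div_sub_le hB hz.2

theorem EuclideanSpace.norm_le_mul_of_forall_abs_le {n : ℕ} {x : EuclideanSpace ℝ (Fin n)} {M : ℝ}
    (hM : 0 ≤ M) (h : ∀ i, |x i| ≤ M) : ‖x‖ ≤ n * M := by
  rw [EuclideanSpace.norm_eq, Real.sqrt_le_left (by positivity)]
  calc ∑ i, ‖x i‖ ^ 2 ≤ ∑ _i : Fin n, M ^ 2 :=
        Finset.sum_le_sum fun i _ => by rw [Real.norm_eq_abs]; gcongr; exact h i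
    _ = n * M ^ 2 := by simp
    _ ≤ (n * M) ^ 2 := by
        rcases Nat.eq_zero_or_pos n with rfl | hn
        · simp
        have : (1 : ℝ) ≤ n := by exact_mod_cast hn
        rw [mul_pow]; gcongr; nlinarith

end Grid

/-- With e = γ or e = α, this turns the mesh condition into the variance decay 4^(-n) that chaining
needs. -/
theorem rpow_inv_pow_le {a e : ℝ} (ha : 0 < a) (he : 2 ≤ a ^ e) (n : ℕ) :
    (1 / a ^ n) ^ (2 * e) ≤ (1 / 4) ^ n := by
  have h1 : (1 / a ^ n) ^ (2 * e) = ((1 / a ^ e) ^ 2) ^ n := by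
    rw [one_div, Real.inv_rpow (by positivity), ← Real.rpow_natCast a n, ← Real.rpow_mul ha.le,
      one_div, inv_pow, inv_pow]
    congr 1
    rw [← pow_mul, ← Real.rpow_natCast, ← Real.rpow_mul ha.le]
    congr 1
    push_cast; ring
  rw [h1]
  gcongr
  have h2 : 1 / a ^ e ≤ 1 / 2 := by gcongr
  calc (1 / a ^ e) ^ 2 ≤ (1 / 2) ^ 2 := by gcongr
    _ = 1 / 4 := by norm_num

theorem abs_sub_le_of_floor_eq {D x y : ℝ} (hD : 0 < D) (hx : 0 ≤ x) (hy : 0 ≤ y)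
    (h : ⌊x * D⌋₊ = ⌊y * D⌋₊) : |x - y| ≤ 1 / D := by
  have h1 := Nat.floor_le (mul_nonneg hx hD.le)
  have h2 := Nat.lt_floor_add_one (x * D)
  have h3 := Nat.floor_le (mul_nonneg hy hD.le)
  have h4 := Nat.lt_floor_add_one (y * D)
  rw [h] at h1 h2
  rw [le_div_iff₀ hD, ← abs_of_pos hD, ← abs_mul, abs_le]
  constructor <;> nlinarith

/-- A function on the cube that is approximated at rate `K * r ^ n` by its values on the grids of
mesh `a ^ (-n)` in space and `b ^ (-n)` in time has a graph of dimension at most `s`, provided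
`a ^ d * b * (r * κ) ^ p < κ ^ s`. -/
theorem dimH_graphOver_le {d p : ℕ} {f : SpaceTime d → EuclideanSpace ℝ (Fin p)}
    {a b κ r K s : ℝ} (hκ : 2 ≤ κ) (hκa : κ ≤ a) (hκb : κ ≤ b) (hr : 1 / 2 ≤ r) (hK : 0 ≤ K)
    (hs : 0 ≤ s)
    (happrox : ∀ i, ∀ z ∈ unitCube d, ∀ n : ℕ,
      |f (gridPoint (a ^ n) (b ^ n) (gridFloor (a ^ n) (b ^ n) z)) i - f z i| ≤ K * r ^ n)
    (hlt : a ^ d * b * (r * κ) ^ p < κ ^ s) :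
    dimH (graphOver f (unitCube d)) ≤ ENNReal.ofReal s := by
  have hκ0 : 0 < κ := by linarith
  have ha0 : 0 < a := by linarith
  have hb0 : 0 < b := by linarith
  have hr0 : 0 < r := by linarith
  have hrκ : 1 ≤ r * κ := by nlinarith
  set R : ℕ → ℝ := fun n => K * r ^ n with hR
  have hR0 : ∀ n, 0 ≤ R n := fun n => by positivity
  -- The values over a cell lie in a window of length 2 `R n` per component, which is cut into slots
  -- of length κ^(-n).
  set M : ℕ → ℕ := fun n => ⌊2 * R n * κ ^ n⌋₊ with hM
  set G : ∀ n, GridIndex d (a ^ n) (b ^ n) → SpaceTime d := fun n =>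
    gridPoint (a ^ n) (b ^ n) with hG
  -- A covering set fixes a cell and a slot for every component. The shift by `R n` makes the
  -- argument of the natural floor nonnegative.
  set t : ∀ n, GridIndex d (a ^ n) (b ^ n) × (Fin p → Fin (M n + 1)) →
      Set (SpaceTime d × EuclideanSpace ℝ (Fin p)) := fun n j =>
    {q | q.1 ∈ unitCube d ∧ gridFloor (a ^ n) (b ^ n) q.1 = j.1 ∧
      ∀ i, |f (G n j.1) i - q.2 i| ≤ R n ∧
        ⌊(q.2 i - f (G n j.1) i + R n) * κ ^ n⌋₊ = j.2 i} with ht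
  -- In units of κ^(-n), the displacements within a covering set are at most 2d in space, 2 in time
  -- and p in value.
  set c : ℝ := 2 * d + 2 + p with hc
  have hc0 : 0 < c := by positivity
  refine dimH_le_of_covering hs t (fun n => c * (1 / κ) ^ n) ?_ (fun n => by positivity) ?_ ?_ ?_
  · have h1 : 1 / κ < 1 := by rw [div_lt_one hκ0]; linarith
    simpa using (tendsto_pow_atTop_nhds_zero_of_lt_one (by positivity) h1).const_mul c
  · rintro n ⟨j, k⟩ ⟨x, y⟩ ⟨hx, hxj, hxk⟩ ⟨x', y'⟩ ⟨hx', hxj', hxk'⟩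
    simp only at hx hxj hxk hx' hxj' hxk'
    have hA : (1 : ℝ) / a ^ n ≤ 1 / κ ^ n := by gcongr
    have hB : (1 : ℝ) / b ^ n ≤ 1 / κ ^ n := by gcongr
    have h1 : ‖x.1 - x'.1‖ ≤ d * (2 * (1 / κ ^ n)) := by
      refine EuclideanSpace.norm_le_mul_of_forall_abs_le (by positivity) fun i => ?_
      have e1 := abs_gridPoint_fst_sub_le (B := b ^ n) (pow_pos ha0 n) hx i
      have e2 := abs_gridPoint_fst_sub_le (B := b ^ n) (pow_pos ha0 n) hx' i
      rw [hxj] at e1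
      rw [hxj'] at e2
      rw [PiLp.sub_apply]
      rw [abs_le] at e1 e2 ⊢
      constructor <;> linarith
    have h2 : ‖x.2 - x'.2‖ ≤ 2 * (1 / κ ^ n) := by
      have e1 := abs_gridPoint_snd_sub_le (A := a ^ n) (pow_pos hb0 n) hx
      have e2 := abs_gridPoint_snd_sub_le (A := a ^ n) (pow_pos hb0 n) hx'
      rw [hxj] at e1
      rw [hxj'] at e2
      rw [Real.norm_eq_abs]
      rw [abs_le] at e1 e2 ⊢
      constructor <;> linarith
    have h3 : ‖y - y'‖ ≤ p * (1 / κ ^ n) := by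
      refine EuclideanSpace.norm_le_mul_of_forall_abs_le (by positivity) fun i => ?_
      have e1 := hxk i
      have e2 := hxk' i
      have e3 := abs_sub_le_of_floor_eq (pow_pos hκ0 n)
        (by have := (abs_le.1 e1.1).2; linarith) (by have := (abs_le.1 e2.1).2; linarith)
        (e1.2.trans e2.2.symm)
      rw [PiLp.sub_apply]
      convert e3 using 2
      ring
    rw [Prod.dist_eq, Prod.dist_eq, dist_eq_norm, dist_eq_norm, dist_eq_norm, div_pow, one_pow]
    have h4 : 0 ≤ 1 / κ ^ n := by positivity
    have h5 : (0 : ℝ) ≤ d * (1 / κ ^ n) := by positivity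
    have h6 : (0 : ℝ) ≤ p * (1 / κ ^ n) := by positivity
    refine max_le (max_le ?_ ?_) ?_ <;> simp only [hc] <;> nlinarith
  · rintro n _ ⟨z, hz, rfl⟩
    have hk : ∀ i, ⌊(f z i - f (G n (gridFloor (a ^ n) (b ^ n) z)) i + R n) * κ ^ n⌋₊ < M n + 1 := by
      intro i
      refine Nat.lt_succ_of_le (Nat.floor_mono ?_)
      have := (abs_le.1 (happrox i z hz n)).1
      gcongr
      simp only [hR, hG]
      linarith
    exact Set.mem_iUnion.2 ⟨(gridFloor (a ^ n) (b ^ n) z, fun i => ⟨_, hk i⟩), hz, rfl,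
      fun i => ⟨happrox i z hz n, rfl⟩⟩
  · set ρ : ℝ := a ^ d * b * (r * κ) ^ p * (κ ^ s)⁻¹ with hρ
    have hρ0 : 0 ≤ ρ := by positivity
    have hρ1 : ρ < 1 := by
      rw [hρ, ← div_eq_mul_inv, div_lt_one (by positivity)]; exact hlt
    have hlim : Tendsto (fun n : ℕ => 2 ^ d * 2 * (2 * K + 1) ^ p * c ^ s * ρ ^ n) atTop (𝓝 0) := by
      simpa using (tendsto_pow_atTop_nhds_zero_of_lt_one hρ0 hρ1).const_mul
        (2 ^ d * 2 * (2 * K + 1) ^ p * c ^ s)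
    refine squeeze_zero (fun n => by positivity) (fun n => ?_) hlim
    have h1 := card_gridIndex_le (d := d) (A := a ^ n) (B := b ^ n)
      (one_le_pow₀ (by linarith)) (one_le_pow₀ (by linarith))
    -- The extra slot is absorbed because rκ ≥ 1.
    have h2 : ((M n + 1 : ℕ) : ℝ) ≤ (2 * K + 1) * (r * κ) ^ n := by
      have h3 : (M n : ℝ) ≤ 2 * R n * κ ^ n := Nat.floor_le (by have := hR0 n; positivity)
      have h4 : 2 * R n * κ ^ n = 2 * K * (r * κ) ^ n := by rw [hR, mul_pow]; ring
      have h5 : 1 ≤ (r * κ) ^ n := one_le_pow₀ hrκ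
      push_cast
      linarith
    have h3 : (Fintype.card (GridIndex d (a ^ n) (b ^ n) × (Fin p → Fin (M n + 1))) : ℝ) ≤
        ((2 * a ^ n) ^ d * (2 * b ^ n)) * ((2 * K + 1) * (r * κ) ^ n) ^ p := by
      rw [Fintype.card_prod, Fintype.card_fun, Fintype.card_fin, Fintype.card_fin, Nat.cast_mul,
        Nat.cast_pow]
      gcongr
    have h4 : (c * (1 / κ) ^ n) ^ s = c ^ s * ((κ ^ s)⁻¹) ^ n := by
      rw [Real.mul_rpow hc0.le (by positivity), one_div, ← Real.rpow_natCast, ← Real.rpow_natCast,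
        ← Real.inv_rpow hκ0.le, ← Real.rpow_mul (by positivity), ← Real.rpow_mul (by positivity),
        mul_comm (n : ℝ)]
    rw [h4]
    calc _ ≤ ((2 * a ^ n) ^ d * (2 * b ^ n)) * ((2 * K + 1) * (r * κ) ^ n) ^ p *
          (c ^ s * ((κ ^ s)⁻¹) ^ n) := by gcongr
      _ = 2 ^ d * 2 * (2 * K + 1) ^ p * c ^ s * ρ ^ n := by
        rw [hρ]
        simp only [mul_pow, ← pow_mul]
        rw [mul_comm n d, mul_comm n p]
        ring

/-- Upper bound for the dimension of the graph of a field whose increments have variance at most of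
order `‖x - y‖ ^ 2γ + |t - s| ^ 2α`. -/
theorem HasIndepGaussianIncrements.ae_dimH_graph_le {d p : ℕ} {Ω : Type*} [MeasurableSpace Ω]
    {P : Measure Ω} {Y : Fin p → SpaceTime d → Ω → ℝ} {V : SpaceTime d → SpaceTime d → ℝ}
    (hY : HasIndepGaussianIncrements P Y V) {α γ L : ℝ} (hα : 0 < α) (hγ : 0 < γ) (hL : 0 ≤ L)
    (hV : ∀ z w, V z w ≤ L * (‖z.1 - w.1‖ ^ (2 * γ) + |z.2 - w.2| ^ (2 * α)))
    {a b κ s : ℝ} (hκ : 2 ≤ κ) (hκa : κ ≤ a) (hκb : κ ≤ b) (ha : 2 ≤ a ^ γ) (hb : 2 ≤ b ^ α)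
    (hs : 0 ≤ s) (hlt : a ^ d * b * (κ / 2) ^ p < κ ^ s) :
    ∀ᵐ ω ∂P, dimH (graphOver (samplePath Y ω) (unitCube d)) ≤ ENNReal.ofReal s := by
  have ha0 : 0 < a := by linarith
  have hb0 : 0 < b := by linarith
  -- Chaining reaches only rates r > 1/2, but the strict inequality at r = 1/2 persists slightly
  -- above it.
  obtain ⟨r, ⟨hr, hr1⟩, hrlt⟩ : ∃ r : ℝ, (1 / 2 < r ∧ r < 1) ∧
      a ^ d * b * (r * κ) ^ p < κ ^ s := by
    have h1 : Tendsto (fun r : ℝ => a ^ d * b * (r * κ) ^ p) (𝓝[>] (1 / 2))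
        (𝓝 (a ^ d * b * (1 / 2 * κ) ^ p)) :=
      (Continuous.tendsto (by fun_prop) _).mono_left nhdsWithin_le_nhds
    have h2 := h1.eventually_lt_const (u := κ ^ s)
      (by rwa [show (1 / 2 * κ : ℝ) = κ / 2 by ring])
    have h3 : ∀ᶠ r : ℝ in 𝓝[>] (1 / 2), r < 1 :=
      nhdsWithin_le_nhds (Iio_mem_nhds (by norm_num))
    have h4 : ∀ᶠ r : ℝ in 𝓝[>] (1 / 2), 1 / 2 < r := self_mem_nhdsWithin
    obtain ⟨r, hr⟩ := (h2.and (h3.and h4)).exists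
    exact ⟨r, ⟨hr.2.2, hr.2.1⟩, hr.1⟩
  -- Consecutive grid points differ by at most 2/a^n in each space coordinate and 2/b^n in time. The
  -- other entry of the maximum `C` below is the cardinality constant of the grids.
  set C1 : ℝ := L * ((2 * d : ℝ) ^ (2 * γ) + 2 ^ (2 * α)) with hC1
  have hC1' : 0 ≤ C1 := by positivity
  set C : ℝ := max C1 (2 ^ d * 2) with hC
  have hC0 : 0 ≤ C := le_max_of_le_left hC1'
  have key : ∀ᵐ ω ∂P, ∀ i, ∃ K : ℝ, 0 ≤ K ∧ ∀ z ∈ unitCube d, ∀ n : ℕ,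
      |Y i (gridPoint (a ^ n) (b ^ n) (gridFloor (a ^ n) (b ^ n) z)) ω - Y i z ω| ≤ K * r ^ n := by
    refine ae_all_iff.2 fun i => ?_
    refine ae_approximation_rate (hY.measurable i) (hY.continuous i) (hY.law i) hY.nonneg
      (fun n => gridPoint (a ^ n) (b ^ n)) (fun n => gridFloor (a ^ n) (b ^ n)) ?_ hC0
      (B := a ^ d * b) (by positivity) ?_ ?_ hr hr1
    · intro z hz
      have hta : Tendsto (fun n : ℕ => 1 / a ^ n) atTop (𝓝 0) := by
        simpa using tendsto_pow_atTop_nhds_zero_of_lt_one (r := a⁻¹) (by positivity)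
          (inv_lt_one_of_one_lt₀ (by linarith))
      have htb : Tendsto (fun n : ℕ => 1 / b ^ n) atTop (𝓝 0) := by
        simpa using tendsto_pow_atTop_nhds_zero_of_lt_one (r := b⁻¹) (by positivity)
          (inv_lt_one_of_one_lt₀ (by linarith))
      have e1 : Tendsto (fun n => (gridPoint (a ^ n) (b ^ n) (gridFloor (a ^ n) (b ^ n) z)).1)
          atTop (𝓝 z.1) := by
        rw [tendsto_iff_norm_sub_tendsto_zero]
        have hda : Tendsto (fun n : ℕ => d * (1 / a ^ n)) atTop (𝓝 0) := by
          simpa using hta.const_mul (d : ℝ)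
        refine squeeze_zero (fun _ => norm_nonneg _) (fun n => ?_) hda
        exact EuclideanSpace.norm_le_mul_of_forall_abs_le (by positivity)
          fun i => abs_gridPoint_fst_sub_le (pow_pos ha0 n) hz i
      have e2 : Tendsto (fun n => (gridPoint (a ^ n) (b ^ n) (gridFloor (a ^ n) (b ^ n) z)).2)
          atTop (𝓝 z.2) := by
        rw [tendsto_iff_norm_sub_tendsto_zero]
        exact squeeze_zero (fun _ => norm_nonneg _)
          (fun n => abs_gridPoint_snd_sub_le (pow_pos hb0 n) hz) htb
      exact e1.prodMk_nhds e2
    · intro n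
      refine (card_gridIndex_le (one_le_pow₀ (by linarith)) (one_le_pow₀ (by linarith))).trans ?_
      calc (2 * a ^ n) ^ d * (2 * b ^ n) = 2 ^ d * 2 * (a ^ d * b) ^ n := by
            simp only [mul_pow, ← pow_mul]
            rw [mul_comm n d]; ring
        _ ≤ _ := by gcongr; exact le_max_right _ _
    · intro z hz n
      refine (hV _ _).trans ?_
      have hA : (1 : ℝ) / a ^ (n + 1) ≤ 1 / a ^ n :=
        one_div_le_one_div_of_le (by positivity) (pow_le_pow_right₀ (by linarith) (by omega))
      have hB : (1 : ℝ) / b ^ (n + 1) ≤ 1 / b ^ n :=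
        one_div_le_one_div_of_le (by positivity) (pow_le_pow_right₀ (by linarith) (by omega))
      set g := gridPoint (a ^ n) (b ^ n) (gridFloor (a ^ n) (b ^ n) z) with hg
      set g' := gridPoint (a ^ (n + 1)) (b ^ (n + 1))
        (gridFloor (a ^ (n + 1)) (b ^ (n + 1)) z) with hg'
      have h1 : ‖g.1 - g'.1‖ ≤ (2 * d) * (1 / a ^ n) := by
        have : ‖g.1 - g'.1‖ ≤ d * (2 * (1 / a ^ n)) := by
          refine EuclideanSpace.norm_le_mul_of_forall_abs_le (by positivity) fun i => ?_
          have e1 := abs_gridPoint_fst_sub_le (B := b ^ n) (pow_pos ha0 n) hz i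
          have e2 := abs_gridPoint_fst_sub_le (B := b ^ (n + 1)) (pow_pos ha0 (n + 1)) hz i
          rw [PiLp.sub_apply]
          rw [abs_le] at e1 e2 ⊢
          constructor <;> linarith
        linarith
      have h2 : |g.2 - g'.2| ≤ 2 * (1 / b ^ n) := by
        have e1 := abs_gridPoint_snd_sub_le (A := a ^ n) (pow_pos hb0 n) hz
        have e2 := abs_gridPoint_snd_sub_le (A := a ^ (n + 1)) (pow_pos hb0 (n + 1)) hz
        rw [abs_le] at e1 e2 ⊢
        constructor <;> linarith
      have h3 : ‖g.1 - g'.1‖ ^ (2 * γ) ≤ (2 * d : ℝ) ^ (2 * γ) * (1 / 4) ^ n := by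
        calc ‖g.1 - g'.1‖ ^ (2 * γ) ≤ ((2 * d) * (1 / a ^ n)) ^ (2 * γ) := by gcongr
          _ = (2 * d : ℝ) ^ (2 * γ) * (1 / a ^ n) ^ (2 * γ) :=
              Real.mul_rpow (by positivity) (by positivity)
          _ ≤ _ := by gcongr; exact rpow_inv_pow_le ha0 ha n
      have h4 : |g.2 - g'.2| ^ (2 * α) ≤ 2 ^ (2 * α) * (1 / 4) ^ n := by
        calc |g.2 - g'.2| ^ (2 * α) ≤ (2 * (1 / b ^ n)) ^ (2 * α) := by gcongr
          _ = 2 ^ (2 * α) * (1 / b ^ n) ^ (2 * α) :=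
              Real.mul_rpow (by positivity) (by positivity)
          _ ≤ _ := by gcongr; exact rpow_inv_pow_le hb0 hb n
      calc L * (‖g.1 - g'.1‖ ^ (2 * γ) + |g.2 - g'.2| ^ (2 * α))
          ≤ L * ((2 * d : ℝ) ^ (2 * γ) * (1 / 4) ^ n + 2 ^ (2 * α) * (1 / 4) ^ n) := by gcongr
        _ = C1 * (1 / 4) ^ n := by rw [hC1]; ring
        _ ≤ _ := by gcongr; exact le_max_left _ _
  filter_upwards [key] with ω hω
  choose K hK0 hK using hω
  refine dimH_graphOver_le hκ hκa hκb hr.le (Finset.sum_nonneg fun i _ => hK0 i) hs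
    (fun i z hz n => ?_) hrlt (K := ∑ i, K i)
  refine (hK i z hz n).trans ?_
  have : K i ≤ ∑ i, K i := Finset.single_le_sum (fun i _ => hK0 i) (Finset.mem_univ i)
  gcongr

/-! ### Negative moments and energy estimates. -/

/-- The norm of a vector dominates the geometric mean of its coordinates. -/
theorem EuclideanSpace.enorm_rpow_neg_le_prod {n : ℕ} (hn : 1 ≤ n) (x : EuclideanSpace ℝ (Fin n))
    {e : ℝ} (he : 0 ≤ e) : ‖x‖ₑ ^ (-e) ≤ ∏ i, ‖x i‖ₑ ^ (-(e / n)) := by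
  have hn' : (n : ℝ) ≠ 0 := by positivity
  calc ‖x‖ₑ ^ (-e) = ∏ _i : Fin n, ‖x‖ₑ ^ (-(e / n)) := by
        rw [Finset.prod_const, Finset.card_univ, Fintype.card_fin, ← ENNReal.rpow_natCast,
          ← ENNReal.rpow_mul]
        congr 1
        field_simp
    _ ≤ _ := by
        refine Finset.prod_le_prod' fun i _ => ?_
        rw [ENNReal.rpow_neg, ENNReal.rpow_neg]
        refine ENNReal.inv_le_inv.2 (ENNReal.rpow_le_rpow ?_ (by positivity))
        rw [enorm_le_iff_norm_le]
        exact PiLp.norm_apply_le x i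

/-- Negative moments of order less than `p` of the increments. -/
theorem HasIndepGaussianIncrements.exists_lintegral_rpow_neg_le {T Ω : Type*} [TopologicalSpace T]
    [MeasurableSpace Ω] {p : ℕ} (hp : 1 ≤ p) {e : ℝ} (he0 : 0 ≤ e) (he : e < p) :
    ∃ C : ℝ≥0∞, C ≠ ∞ ∧ ∀ {P : Measure Ω} {Y : Fin p → T → Ω → ℝ} {V : T → T → ℝ},
      HasIndepGaussianIncrements P Y V → ∀ z w, 0 < V z w →
      ∫⁻ ω, ‖WithLp.toLp 2 (fun i => Y i z ω - Y i w ω)‖ₑ ^ (-e) ∂P ≤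
        C * ENNReal.ofReal (V z w) ^ (-(e / 2)) := by
  have hp' : (0 : ℝ) < p := by positivity
  -- Sharing the exponent among p independent coordinates brings each below 1, the integrability
  -- threshold on the line.
  have hep : e / p < 1 := by rwa [div_lt_one hp']
  set m : ℝ≥0∞ := ∫⁻ x, ‖x‖ₑ ^ (-(e / p)) ∂gaussianReal 0 1 with hm
  refine ⟨m ^ p, ENNReal.pow_ne_top (lintegral_rpow_neg_gaussianReal_ne_top (by positivity) hep),
    fun {P Y V} hY z w hV => ?_⟩
  have hXm : ∀ i, Measurable fun ω => Y i z ω - Y i w ω := fun i =>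
    (hY.measurable i z).sub (hY.measurable i w)
  calc ∫⁻ ω, ‖WithLp.toLp 2 (fun i => Y i z ω - Y i w ω)‖ₑ ^ (-e) ∂P
      ≤ ∫⁻ ω, ∏ i, ‖Y i z ω - Y i w ω‖ₑ ^ (-(e / p)) ∂P :=
        lintegral_mono fun ω => EuclideanSpace.enorm_rpow_neg_le_prod hp _ he0
    _ = ∏ i, ∫⁻ ω, ‖Y i z ω - Y i w ω‖ₑ ^ (-(e / p)) ∂P := by
        refine lintegral_prod_eq_prod_lintegral_of_indepFun Finset.univ
          (fun i ω => ‖Y i z ω - Y i w ω‖ₑ ^ (-(e / p))) ?_ fun i => by have := hXm i; fun_prop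
        exact (hY.indep z w).comp (fun _ x => ‖x‖ₑ ^ (-(e / p))) fun _ => by fun_prop
    _ = ∏ _i : Fin p, ENNReal.ofReal (Real.sqrt (V z w)) ^ (-(e / p)) * m := by
        refine Finset.prod_congr rfl fun i _ => ?_
        rw [hm, ← lintegral_rpow_gaussianReal hV, ← hY.law i,
          lintegral_map (by fun_prop) (hXm i)]
    _ = _ := by
        rw [Finset.prod_const, Finset.card_univ, Fintype.card_fin, mul_pow, mul_comm]
        congr 1
        rw [← ENNReal.rpow_natCast, ← ENNReal.rpow_mul, Real.sqrt_eq_rpow,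
          ← ENNReal.ofReal_rpow_of_pos hV, ← ENNReal.rpow_mul]
        congr 1
        field_simp

/-- Lebesgue measure on `[0, 1]`. -/
noncomputable abbrev unitIntervalMeasure : Measure ℝ := volume.restrict (Set.Icc 0 1)

instance : IsProbabilityMeasure unitIntervalMeasure := ⟨by simp⟩

/-- The uniform distribution on the cube. -/
noncomputable def cubeMeasure (d : ℕ) : Measure (SpaceTime d) :=
  ((Measure.pi fun _ : Fin d => unitIntervalMeasure).prod unitIntervalMeasure).map
    fun q => (WithLp.toLp 2 q.1, q.2)

theorem measurable_toLp_prod (d : ℕ) :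
    Measurable fun q : (Fin d → ℝ) × ℝ => ((WithLp.toLp 2 q.1, q.2) : SpaceTime d) := by
  fun_prop

instance (d : ℕ) : IsProbabilityMeasure (cubeMeasure d) :=
  Measure.isProbabilityMeasure_map (measurable_toLp_prod d).aemeasurable

theorem measurableSet_unitCube (d : ℕ) : MeasurableSet (unitCube d) := by
  have : unitCube d = (⋂ i, (fun z : SpaceTime d => z.1 i) ⁻¹' Set.Icc 0 1) ∩
      Prod.snd ⁻¹' Set.Icc 0 1 := by
    ext z; simp [unitCube]
  rw [this]
  refine (MeasurableSet.iInter fun i => ?_).inter (measurable_snd measurableSet_Icc)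
  exact (by fun_prop : Measurable fun z : SpaceTime d => z.1 i) measurableSet_Icc

theorem ae_mem_unitCube (d : ℕ) : ∀ᵐ z ∂cubeMeasure d, z ∈ unitCube d := by
  have hI : ∀ᵐ x ∂unitIntervalMeasure, x ∈ Set.Icc (0 : ℝ) 1 := ae_restrict_mem measurableSet_Icc
  rw [cubeMeasure]
  refine (ae_map_iff (p := fun z => z ∈ unitCube d) (measurable_toLp_prod d).aemeasurable
    (measurableSet_unitCube d)).2 ?_
  have h1 : ∀ᵐ x ∂(Measure.pi fun _ : Fin d => unitIntervalMeasure), ∀ i, x i ∈ Set.Icc (0 : ℝ) 1 :=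
    ae_all_iff.2 fun i => (Measure.quasiMeasurePreserving_eval _ i).ae hI
  have h2 := (Measure.quasiMeasurePreserving_fst (ν := unitIntervalMeasure)).ae h1
  have h3 := (Measure.quasiMeasurePreserving_snd
    (μ := Measure.pi fun _ : Fin d => unitIntervalMeasure)).ae hI
  filter_upwards [h2, h3] with q hq1 hq2
  exact ⟨hq1, hq2⟩

/-- The anisotropic Riesz kernel is integrable over the cube, uniformly in the base point. -/
theorem exists_lintegral_cubeMeasure_le {d : ℕ} (hd : 1 ≤ d) {A B : ℝ} (hA0 : 0 ≤ A) (hA : A < d)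
    (hB0 : 0 ≤ B) (hB : B < 1) :
    ∃ C : ℝ≥0∞, C ≠ ∞ ∧ ∀ z : SpaceTime d,
      ∫⁻ w, ‖z.1 - w.1‖ₑ ^ (-A) * ‖z.2 - w.2‖ₑ ^ (-B) ∂cubeMeasure d ≤ C := by
  have hd' : (0 : ℝ) < d := by positivity
  have hAd : A / d < 1 := by rwa [div_lt_one hd']
  have hμ : unitIntervalMeasure ≤ volume := Measure.restrict_le_self
  refine ⟨(singularIntegral (A / d) + 1) ^ d * (singularIntegral B + 1), ?_, fun z => ?_⟩
  · refine ENNReal.mul_ne_top (ENNReal.pow_ne_top ?_) ?_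
    · simp [singularIntegral_ne_top hAd]
    · simp [singularIntegral_ne_top hB]
  rw [cubeMeasure, lintegral_map (by fun_prop) (measurable_toLp_prod d)]
  rw [lintegral_prod_mul (f := fun x : Fin d → ℝ => ‖z.1 - WithLp.toLp 2 x‖ₑ ^ (-A))
    (g := fun t : ℝ => ‖z.2 - t‖ₑ ^ (-B)) (by fun_prop) (by fun_prop)]
  refine mul_le_mul' ?_ (lintegral_sub_rpow_neg_le hμ hB0 _)
  calc ∫⁻ x, ‖z.1 - WithLp.toLp 2 x‖ₑ ^ (-A) ∂(Measure.pi fun _ : Fin d => unitIntervalMeasure)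
      ≤ ∫⁻ x, ∏ i, ‖z.1 i - x i‖ₑ ^ (-(A / d))
          ∂(Measure.pi fun _ : Fin d => unitIntervalMeasure) :=
        lintegral_mono fun x => EuclideanSpace.enorm_rpow_neg_le_prod hd _ hA0
    _ = ∏ i, ∫⁻ x, ‖z.1 i - x i‖ₑ ^ (-(A / d))
          ∂(Measure.pi fun _ : Fin d => unitIntervalMeasure) := by
        -- The coordinates are independent under the product measure, so the geometric-mean bound
        -- factorises as it does for the increments.
        refine lintegral_prod_eq_prod_lintegral_of_indepFun Finset.univ
          (fun i (x : Fin d → ℝ) => ‖z.1 i - x i‖ₑ ^ (-(A / d))) ?_ fun i => by fun_prop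
        exact iIndepFun_pi (X := fun i (x : ℝ) => ‖z.1 i - x‖ₑ ^ (-(A / d)))
          fun i => by fun_prop
    _ ≤ ∏ _i : Fin d, (singularIntegral (A / d) + 1) := by
        refine Finset.prod_le_prod' fun i _ => ?_
        rw [(measurePreserving_eval (fun _ : Fin d => unitIntervalMeasure) i).lintegral_comp
          (f := fun x => ‖z.1 i - x‖ₑ ^ (-(A / d))) (by fun_prop)]
        exact lintegral_sub_rpow_neg_le hμ (by positivity) _
    _ = _ := by simp

/-- Continuity in the parameter and measurability in ω give joint measurability, which Tonelli's
theorem requires. -/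
theorem HasIndepGaussianIncrements.measurable_uncurry {d p : ℕ} {Ω : Type*} [MeasurableSpace Ω]
    {P : Measure Ω} {Y : Fin p → SpaceTime d → Ω → ℝ} {V : SpaceTime d → SpaceTime d → ℝ}
    (hY : HasIndepGaussianIncrements P Y V) (i : Fin p) :
    Measurable fun q : Ω × SpaceTime d => Y i q.2 q.1 := by
  have h := measurable_uncurry_of_continuous_of_measurable (u := Y i) (hY.continuous i)
    (hY.measurable i)
  exact h.comp measurable_swap

/-- Energy estimate for fields whose increments have variance at least of order
`max (‖x - y‖ ^ 2γ) (|t - s| ^ 2α)`. The exponents `a₁`, `a₂` are the parts of the exponent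
of the increment charged to space and time, `b₁`, `b₂` those of the displacement. -/
theorem HasIndepGaussianIncrements.ae_energy_lt_top {d p : ℕ} {Ω : Type*} [MeasurableSpace Ω]
    {P : Measure Ω} [IsProbabilityMeasure P]
    {Y : Fin p → SpaceTime d → Ω → ℝ} {V : SpaceTime d → SpaceTime d → ℝ}
    (hY : HasIndepGaussianIncrements P Y V) (hd : 1 ≤ d) (hp : 1 ≤ p) {α γ k : ℝ} (hα : 0 < α)
    (hγ : 0 < γ) (hk : 0 < k)
    (hVx : ∀ z ∈ unitCube d, ∀ w ∈ unitCube d, k * ‖z.1 - w.1‖ ^ (2 * γ) ≤ V z w)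
    (hVt : ∀ z ∈ unitCube d, ∀ w ∈ unitCube d, k * |z.2 - w.2| ^ (2 * α) ≤ V z w)
    {a₁ a₂ b₁ b₂ : ℝ} (ha₁ : 0 < a₁) (ha₂ : 0 < a₂) (hb₁ : 0 ≤ b₁) (hb₂ : 0 ≤ b₂)
    (hspace : γ * a₁ + b₁ < d) (htime : α * a₂ + b₂ < 1) (hap : a₁ + a₂ < p) :
    ∀ᵐ ω ∂P, ∫⁻ z, ∫⁻ w, ‖z.1 - w.1‖ₑ ^ (-b₁) * ‖z.2 - w.2‖ₑ ^ (-b₂) *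
      edist (samplePath Y ω z) (samplePath Y ω w) ^ (-(a₁ + a₂)) ∂cubeMeasure d ∂cubeMeasure d
        < ∞ := by
  have hYm := hY.measurable_uncurry
  have hYm1 : ∀ i, Measurable fun q : Ω × SpaceTime d × SpaceTime d => Y i q.2.1 q.1 := fun i =>
    (hYm i).comp (by fun_prop : Measurable fun q : Ω × SpaceTime d × SpaceTime d => (q.1, q.2.1))
  have hYm2 : ∀ i, Measurable fun q : Ω × SpaceTime d × SpaceTime d => Y i q.2.2 q.1 := fun i =>
    (hYm i).comp (by fun_prop : Measurable fun q : Ω × SpaceTime d × SpaceTime d => (q.1, q.2.2))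
  set Kf : Ω × SpaceTime d × SpaceTime d → ℝ≥0∞ := fun q =>
    ‖q.2.1.1 - q.2.2.1‖ₑ ^ (-b₁) * ‖q.2.1.2 - q.2.2.2‖ₑ ^ (-b₂) *
      edist (samplePath Y q.1 q.2.1) (samplePath Y q.1 q.2.2) ^ (-(a₁ + a₂)) with hKf
  have hs1 : Measurable fun q : Ω × SpaceTime d × SpaceTime d => samplePath Y q.1 q.2.1 :=
    (WithLp.measurable_toLp 2 _).comp (measurable_pi_lambda _ hYm1)
  have hs2 : Measurable fun q : Ω × SpaceTime d × SpaceTime d => samplePath Y q.1 q.2.2 :=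
    (WithLp.measurable_toLp 2 _).comp (measurable_pi_lambda _ hYm2)
  have hKm : Measurable Kf := by
    have h := hs1.edist hs2
    fun_prop
  set μ := cubeMeasure d with hμ
  have hprod : ∀ ω, ∫⁻ z, ∫⁻ w, Kf (ω, z, w) ∂μ ∂μ = ∫⁻ q, Kf (ω, q) ∂(μ.prod μ) := fun ω =>
    (lintegral_prod (fun q => Kf (ω, q)) (hKm.comp measurable_prodMk_left).aemeasurable).symm
  have hEm : Measurable fun ω => ∫⁻ q, Kf (ω, q) ∂(μ.prod μ) := hKm.lintegral_prod_right'
  suffices hfin : ∫⁻ ω, ∫⁻ q, Kf (ω, q) ∂(μ.prod μ) ∂P ≠ ∞ by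
    filter_upwards [ae_lt_top hEm hfin] with ω hω
    rw [← hprod ω] at hω
    exact hω
  obtain ⟨C1, hC1, hmom⟩ := HasIndepGaussianIncrements.exists_lintegral_rpow_neg_le
    (T := SpaceTime d) (Ω := Ω) hp (add_pos ha₁ ha₂).le hap
  obtain ⟨C2, hC2, hint⟩ := exists_lintegral_cubeMeasure_le hd (A := γ * a₁ + b₁)
    (B := α * a₂ + b₂) (by positivity) hspace (by positivity) htime
  set κ : ℝ≥0∞ := ENNReal.ofReal k with hκ
  have hκ0 : κ ≠ 0 := by simpa [hκ] using hk
  have hκt : κ ≠ ∞ := by simp [hκ]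
  -- `C1 + 1` keeps `C3` nonzero, so that `C3` times an infinite kernel is infinite.
  set C3 : ℝ≥0∞ := (C1 + 1) * (κ ^ (-(a₁ / 2)) * κ ^ (-(a₂ / 2))) with hC3
  have hC3t : C3 ≠ ∞ := ENNReal.mul_ne_top (by simp [hC1])
    (ENNReal.mul_ne_top (ENNReal.rpow_ne_top_of_ne_zero hκ0 hκt)
      (ENNReal.rpow_ne_top_of_ne_zero hκ0 hκt))
  have hpos : ∀ (x : ℝ≥0∞) (e : ℝ), 0 ≤ e → x ≠ ∞ → x ^ (-e) ≠ 0 := fun x e he hx => by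
    rw [ENNReal.rpow_neg]
    exact ENNReal.inv_ne_zero.2 (ENNReal.rpow_ne_top_of_nonneg he hx)
  have hC30 : C3 ≠ 0 := mul_ne_zero (by simp) (mul_ne_zero (hpos _ _ (by positivity) hκt)
    (hpos _ _ (by positivity) hκt))
  have hVpow : ∀ (V x e f : ℝ), 0 < x → 0 ≤ f → k * x ^ (2 * e) ≤ V →
      ENNReal.ofReal V ^ (-(f / 2)) ≤ κ ^ (-(f / 2)) * ENNReal.ofReal x ^ (-(e * f)) := by
    intro V x e f hx hf hle
    have h1 : ENNReal.ofReal V ^ (-(f / 2)) ≤ (κ * ENNReal.ofReal x ^ (2 * e)) ^ (-(f / 2)) := by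
      rw [ENNReal.rpow_neg, ENNReal.rpow_neg]
      refine ENNReal.inv_le_inv.2 (ENNReal.rpow_le_rpow ?_ (by positivity))
      rw [hκ, ENNReal.ofReal_rpow_of_pos hx, ← ENNReal.ofReal_mul hk.le]
      exact ENNReal.ofReal_le_ofReal hle
    refine h1.trans_eq ?_
    have h2 : ENNReal.ofReal x ≠ 0 := by simpa using hx
    rw [ENNReal.mul_rpow_of_ne_top hκt (ENNReal.rpow_ne_top_of_ne_zero h2 (by simp)),
      ← ENNReal.rpow_mul]
    congr 2
    ring
  have hpoint : ∀ z ∈ unitCube d, ∀ w ∈ unitCube d, ∫⁻ ω, Kf (ω, z, w) ∂P ≤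
      C3 * (‖z.1 - w.1‖ₑ ^ (-(γ * a₁ + b₁)) * ‖z.2 - w.2‖ₑ ^ (-(α * a₂ + b₂))) := by
    intro z hz w hw
    -- If the space or time coordinates coincide the right side is infinite, because a₁, a₂ > 0 make
    -- both exponents negative.
    by_cases hx : z.1 = w.1
    · have : ‖z.1 - w.1‖ₑ ^ (-(γ * a₁ + b₁)) = ∞ := by
        rw [hx, sub_self, enorm_zero, ENNReal.zero_rpow_of_neg (by nlinarith [mul_pos hγ ha₁])]
      rw [this, ENNReal.top_mul (hpos _ _ (by positivity) (by simp)), ENNReal.mul_top hC30]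
      exact le_top
    by_cases ht : z.2 = w.2
    · have : ‖z.2 - w.2‖ₑ ^ (-(α * a₂ + b₂)) = ∞ := by
        rw [ht, sub_self, enorm_zero, ENNReal.zero_rpow_of_neg (by nlinarith [mul_pos hα ha₂])]
      rw [this, ENNReal.mul_top (hpos _ _ (by positivity) (by simp)), ENNReal.mul_top hC30]
      exact le_top
    have hx0 : 0 < ‖z.1 - w.1‖ := norm_pos_iff.2 (sub_ne_zero.2 hx)
    have ht0 : 0 < |z.2 - w.2| := abs_pos.2 (sub_ne_zero.2 ht)
    have hV0 : 0 < V z w := lt_of_lt_of_le (by positivity) (hVx z hz w hw)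
    have e1 : ENNReal.ofReal ‖z.1 - w.1‖ = ‖z.1 - w.1‖ₑ := ofReal_norm _
    have e2 : ENNReal.ofReal |z.2 - w.2| = ‖z.2 - w.2‖ₑ := (Real.enorm_eq_ofReal_abs _).symm
    have hx1 : ‖z.1 - w.1‖ₑ ≠ 0 := by rw [← e1]; simpa using hx0
    have ht1 : ‖z.2 - w.2‖ₑ ≠ 0 := by rw [← e2]; simpa using ht0
    have m1 := hVpow (V z w) ‖z.1 - w.1‖ γ a₁ hx0 ha₁.le (hVx z hz w hw)
    have m2 := hVpow (V z w) |z.2 - w.2| α a₂ ht0 ha₂.le (hVt z hz w hw)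
    rw [e1] at m1
    rw [e2] at m2
    -- The decisive split: one power of the variance is bounded through the displacement in space,
    -- the other through that in time.
    have hVs : ENNReal.ofReal (V z w) ^ (-((a₁ + a₂) / 2)) =
        ENNReal.ofReal (V z w) ^ (-(a₁ / 2)) * ENNReal.ofReal (V z w) ^ (-(a₂ / 2)) := by
      rw [← ENNReal.rpow_add _ _ (by simpa using hV0) (by simp)]
      congr 1; ring
    have hsx : ‖z.1 - w.1‖ₑ ^ (-(γ * a₁ + b₁)) =
        ‖z.1 - w.1‖ₑ ^ (-b₁) * ‖z.1 - w.1‖ₑ ^ (-(γ * a₁)) := by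
      rw [← ENNReal.rpow_add _ _ hx1 (by simp)]; congr 1; ring
    have hst : ‖z.2 - w.2‖ₑ ^ (-(α * a₂ + b₂)) =
        ‖z.2 - w.2‖ₑ ^ (-b₂) * ‖z.2 - w.2‖ₑ ^ (-(α * a₂)) := by
      rw [← ENNReal.rpow_add _ _ ht1 (by simp)]; congr 1; ring
    have hed : ∀ ω, edist (samplePath Y ω z) (samplePath Y ω w) =
        ‖WithLp.toLp 2 (fun i => Y i z ω - Y i w ω)‖ₑ := fun ω => by
      rw [edist_eq_enorm_sub]; rfl
    have hm : Measurable fun ω =>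
        ‖WithLp.toLp 2 (fun i => Y i z ω - Y i w ω)‖ₑ ^ (-(a₁ + a₂)) := by
      have : Measurable fun ω => WithLp.toLp 2 (fun i => Y i z ω - Y i w ω) :=
        (WithLp.measurable_toLp 2 _).comp (measurable_pi_lambda _ fun i =>
          (hY.measurable i z).sub (hY.measurable i w))
      fun_prop
    simp only [hKf, hed]
    rw [lintegral_const_mul _ hm, hsx, hst]
    calc ‖z.1 - w.1‖ₑ ^ (-b₁) * ‖z.2 - w.2‖ₑ ^ (-b₂) *
          ∫⁻ ω, ‖WithLp.toLp 2 (fun i => Y i z ω - Y i w ω)‖ₑ ^ (-(a₁ + a₂)) ∂P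
        ≤ ‖z.1 - w.1‖ₑ ^ (-b₁) * ‖z.2 - w.2‖ₑ ^ (-b₂) * ((C1 + 1) *
          ((κ ^ (-(a₁ / 2)) * ‖z.1 - w.1‖ₑ ^ (-(γ * a₁))) *
            (κ ^ (-(a₂ / 2)) * ‖z.2 - w.2‖ₑ ^ (-(α * a₂))))) := by
          gcongr
          refine (hmom hY z w hV0).trans ?_
          rw [hVs]
          exact mul_le_mul' le_self_add (mul_le_mul' m1 m2)
      _ = _ := by rw [hC3]; ring
  rw [lintegral_lintegral_swap (by fun_prop), lintegral_prod _ (by fun_prop)]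
  have hbound : ∫⁻ z, ∫⁻ w, ∫⁻ ω, Kf (ω, z, w) ∂P ∂μ ∂μ ≤ C3 * C2 := by
    calc ∫⁻ z, ∫⁻ w, ∫⁻ ω, Kf (ω, z, w) ∂P ∂μ ∂μ ≤ ∫⁻ _z, C3 * C2 ∂μ := by
          refine lintegral_mono_ae ?_
          filter_upwards [ae_mem_unitCube d] with z hz
          calc ∫⁻ w, ∫⁻ ω, Kf (ω, z, w) ∂P ∂μ
              ≤ ∫⁻ w, C3 * (‖z.1 - w.1‖ₑ ^ (-(γ * a₁ + b₁)) *
                  ‖z.2 - w.2‖ₑ ^ (-(α * a₂ + b₂))) ∂μ := by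
                refine lintegral_mono_ae ?_
                filter_upwards [ae_mem_unitCube d] with w hw
                exact hpoint z hz w hw
            _ ≤ C3 * C2 := by
                rw [lintegral_const_mul _ (by fun_prop)]
                gcongr
                exact hint z
      _ = C3 * C2 := by simp
  exact ne_top_of_le_ne_top (ENNReal.mul_ne_top hC3t hC2) hbound

/-- `D` stands for the distance in the graph, which dominates the displacements in space, time and
value. The condition a > 0 makes the right side infinite when D = 0, as the left side may be. -/
theorem ENNReal.rpow_neg_add_le_mul {D x y u : ℝ≥0∞} (hD : D ≠ ∞) (hx : x ≤ D) (hy : y ≤ D)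
    (hu : u ≤ D) {e f a : ℝ} (he : 0 ≤ e) (hf : 0 ≤ f) (ha : 0 < a) :
    D ^ (-(a + e + f)) ≤ x ^ (-e) * y ^ (-f) * u ^ (-a) := by
  have hanti : ∀ {v : ℝ≥0∞} {g : ℝ}, 0 ≤ g → v ≤ D → D ^ (-g) ≤ v ^ (-g) := fun hg hv => by
    rw [ENNReal.rpow_neg, ENNReal.rpow_neg]
    exact ENNReal.inv_le_inv.2 (ENNReal.rpow_le_rpow hv hg)
  have hpos : ∀ {v : ℝ≥0∞} {g : ℝ}, 0 ≤ g → v ≤ D → v ^ (-g) ≠ 0 := fun hg hv => by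
    rw [ENNReal.rpow_neg]
    exact ENNReal.inv_ne_zero.2 (ENNReal.rpow_ne_top_of_nonneg hg (ne_top_of_le_ne_top hD hv))
  rcases eq_or_ne D 0 with rfl | hD0
  · have hu0 : u = 0 := le_antisymm hu bot_le
    rw [hu0, ENNReal.zero_rpow_of_neg (by linarith : -a < 0),
      ENNReal.mul_top (mul_ne_zero (hpos he hx) (hpos hf hy))]
    exact le_top
  calc D ^ (-(a + e + f)) = D ^ (-e) * D ^ (-f) * D ^ (-a) := by
        rw [← ENNReal.rpow_add _ _ hD0 hD, ← ENNReal.rpow_add _ _ hD0 hD]; congr 1; ring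
    _ ≤ _ := mul_le_mul' (mul_le_mul' (hanti he hx) (hanti hf hy)) (hanti ha.le hu)

/-- Given exponents that satisfy the weak energy constraints, the shrunken and shifted exponents
satisfy the strict ones. -/
theorem HasIndepGaussianIncrements.ae_energy_lt_top_of_le {d p : ℕ} {Ω : Type*}
    [MeasurableSpace Ω] {P : Measure Ω} [IsProbabilityMeasure P]
    {Y : Fin p → SpaceTime d → Ω → ℝ} {V : SpaceTime d → SpaceTime d → ℝ}
    (hY : HasIndepGaussianIncrements P Y V) (hd : 1 ≤ d) (hp : 1 ≤ p) {α γ k : ℝ} (hα : 0 < α)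
    (hγ : 0 < γ) (hα1 : α ≤ 1) (hγ1 : γ ≤ 1) (hk : 0 < k)
    (hVx : ∀ z ∈ unitCube d, ∀ w ∈ unitCube d, k * ‖z.1 - w.1‖ ^ (2 * γ) ≤ V z w)
    (hVt : ∀ z ∈ unitCube d, ∀ w ∈ unitCube d, k * |z.2 - w.2| ^ (2 * α) ≤ V z w)
    {a₁ a₂ b₁ b₂ : ℝ} (ha₁ : 0 ≤ a₁) (ha₂ : 0 ≤ a₂) (hb₁ : 0 ≤ b₁) (hb₂ : 0 ≤ b₂)
    (hspace : γ * a₁ + b₁ ≤ d) (htime : α * a₂ + b₂ ≤ 1) (hap : a₁ + a₂ ≤ p) {θ : ℝ}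
    (hθ0 : 0 < θ) (hθ : θ < 1) :
    ∃ a : ℝ, 0 < a ∧ θ * (a₁ + a₂) ≤ a ∧
      ∀ᵐ ω ∂P, ∫⁻ z, ∫⁻ w, ‖z.1 - w.1‖ₑ ^ (-(θ * b₁)) * ‖z.2 - w.2‖ₑ ^ (-(θ * b₂)) *
        edist (samplePath Y ω z) (samplePath Y ω w) ^ (-a) ∂cubeMeasure d ∂cubeMeasure d < ∞ := by
  have hd' : (1 : ℝ) ≤ d := by exact_mod_cast hd
  have hp' : (1 : ℝ) ≤ p := by exact_mod_cast hp
  -- Shrinking by θ frees at least 4δ in each constraint, since d, p ≥ 1. Raising both increment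
  -- exponents by δ costs at most δ in space, δ in time and 2δ in their sum, and makes them
  -- positive.
  set δ := (1 - θ) / 4 with hδ
  have hδ0 : 0 < δ := by rw [hδ]; linarith
  have h4 : 1 - θ = 4 * δ := by rw [hδ]; ring
  refine ⟨(θ * a₁ + δ) + (θ * a₂ + δ), by positivity, by linarith, ?_⟩
  refine hY.ae_energy_lt_top hd hp hα hγ hk hVx hVt (by positivity) (by positivity)
    (by positivity) (by positivity) ?_ ?_ ?_
  · have h1 : θ * (γ * a₁ + b₁) ≤ θ * d := by gcongr
    have h2 : γ * δ ≤ δ := by nlinarith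
    have h3 : (1 - θ) * 1 ≤ (1 - θ) * d := by gcongr
    linarith
  · have h1 : θ * (α * a₂ + b₂) ≤ θ * 1 := by gcongr
    have h2 : α * δ ≤ δ := by nlinarith
    linarith
  · have h1 : θ * (a₁ + a₂) ≤ θ * p := by gcongr
    have h3 : (1 - θ) * 1 ≤ (1 - θ) * p := by gcongr
    linarith

/-! ### Lower bounds from feasible exponents. -/

section LowerBounds

variable {d p : ℕ} {Ω : Type*} [MeasurableSpace Ω] {P : Measure Ω}
  {Y : Fin p → SpaceTime d → Ω → ℝ} {V : SpaceTime d → SpaceTime d → ℝ}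

theorem HasIndepGaussianIncrements.continuous_samplePath
    (hY : HasIndepGaussianIncrements P Y V) (ω : Ω) : Continuous (samplePath Y ω) :=
  (PiLp.continuous_toLp 2 _).comp (continuous_pi fun i => hY.continuous i ω)

theorem HasIndepGaussianIncrements.ae_le_dimH_graph [IsProbabilityMeasure P]
    (hY : HasIndepGaussianIncrements P Y V) (hd : 1 ≤ d) (hp : 1 ≤ p) {α γ k : ℝ} (hα : 0 < α)
    (hγ : 0 < γ) (hα1 : α ≤ 1) (hγ1 : γ ≤ 1) (hk : 0 < k)
    (hVx : ∀ z ∈ unitCube d, ∀ w ∈ unitCube d, k * ‖z.1 - w.1‖ ^ (2 * γ) ≤ V z w)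
    (hVt : ∀ z ∈ unitCube d, ∀ w ∈ unitCube d, k * |z.2 - w.2| ^ (2 * α) ≤ V z w)
    {a₁ a₂ b₁ b₂ : ℝ} (ha₁ : 0 ≤ a₁) (ha₂ : 0 ≤ a₂) (hb₁ : 0 ≤ b₁) (hb₂ : 0 ≤ b₂)
    (hspace : γ * a₁ + b₁ ≤ d) (htime : α * a₂ + b₂ ≤ 1) (hap : a₁ + a₂ ≤ p) :
    ∀ᵐ ω ∂P, ENNReal.ofReal (a₁ + a₂ + b₁ + b₂) ≤
      dimH (graphOver (samplePath Y ω) (unitCube d)) := by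
  refine ae_ofReal_le_of_forall_lt fun θ hθ0 hθ => ?_
  obtain ⟨a, ha0, ha, hfin⟩ := hY.ae_energy_lt_top_of_le hd hp hα hγ hα1 hγ1 hk hVx hVt ha₁ ha₂
    hb₁ hb₂ hspace htime hap hθ0 hθ
  have hc₁ : 0 ≤ θ * b₁ := by positivity
  have hc₂ : 0 ≤ θ * b₂ := by positivity
  filter_upwards [hfin] with ω hω
  have hF : Measurable fun z : SpaceTime d => (z, samplePath Y ω z) :=
    measurable_id.prodMk (hY.continuous_samplePath ω).measurable
  refine le_trans (ENNReal.ofReal_le_ofReal (by linarith))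
    (le_dimH_of_energy_lt_top (cubeMeasure d) (IsProbabilityMeasure.ne_zero _) hF
      (s := a + θ * b₁ + θ * b₂) (by positivity) (lt_of_le_of_lt ?_ hω)
      ((ae_mem_unitCube d).mono fun z hz => ⟨z, hz, rfl⟩))
  refine lintegral_mono fun z => lintegral_mono fun w => ?_
  refine ENNReal.rpow_neg_add_le_mul (edist_ne_top _ _) ?_ ?_ ?_ hc₁ hc₂ ha0
  · rw [← edist_eq_enorm_sub, Prod.edist_eq, Prod.edist_eq]
    exact (le_max_left _ _).trans (le_max_left _ _)
  · rw [← edist_eq_enorm_sub, Prod.edist_eq, Prod.edist_eq]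
    exact (le_max_right _ _).trans (le_max_left _ _)
  · rw [Prod.edist_eq]
    exact le_max_right _ _

theorem HasIndepGaussianIncrements.ae_le_dimH_image [IsProbabilityMeasure P]
    (hY : HasIndepGaussianIncrements P Y V) (hd : 1 ≤ d) (hp : 1 ≤ p) {α γ k : ℝ} (hα : 0 < α)
    (hγ : 0 < γ) (hα1 : α ≤ 1) (hγ1 : γ ≤ 1) (hk : 0 < k)
    (hVx : ∀ z ∈ unitCube d, ∀ w ∈ unitCube d, k * ‖z.1 - w.1‖ ^ (2 * γ) ≤ V z w)
    (hVt : ∀ z ∈ unitCube d, ∀ w ∈ unitCube d, k * |z.2 - w.2| ^ (2 * α) ≤ V z w)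
    {a₁ a₂ : ℝ} (ha₁ : 0 ≤ a₁) (ha₂ : 0 ≤ a₂) (hspace : γ * a₁ ≤ d) (htime : α * a₂ ≤ 1)
    (hap : a₁ + a₂ ≤ p) :
    ∀ᵐ ω ∂P, ENNReal.ofReal (a₁ + a₂) ≤ dimH (samplePath Y ω '' unitCube d) := by
  refine ae_ofReal_le_of_forall_lt fun θ hθ0 hθ => ?_
  obtain ⟨a, ha0, ha, hfin⟩ := hY.ae_energy_lt_top_of_le hd hp hα hγ hα1 hγ1 hk hVx hVt ha₁ ha₂
    le_rfl le_rfl (by linarith) (by linarith) hap hθ0 hθ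
  filter_upwards [hfin] with ω hω
  refine le_trans (ENNReal.ofReal_le_ofReal ha)
    (le_dimH_of_energy_lt_top (cubeMeasure d) (IsProbabilityMeasure.ne_zero _)
      (hY.continuous_samplePath ω).measurable ha0 ?_
      ((ae_mem_unitCube d).mono fun z hz => ⟨z, hz, rfl⟩))
  simpa using hω

end LowerBounds

/-! ### From the stationary field to independent Gaussian increments. -/

/-- The variogram of a stationary covariance function. -/
noncomputable def variogram {d : ℕ} (C : EuclideanSpace ℝ (Fin d) → ℝ → ℝ)
    (z w : SpaceTime d) : ℝ :=
  2 * (C 0 0 - C (z.1 - w.1) (z.2 - w.2))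

/-- Expanding the square identifies the variogram with the variance of the increment; hence it is
nonnegative and `toNNReal` truncates nothing. -/
theorem IsCenteredStationaryGaussianField.map_sub {d : ℕ} {Ω : Type*} [MeasurableSpace Ω]
    {P : Measure Ω} [IsProbabilityMeasure P] {X : SpaceTime d → Ω → ℝ}
    {C : EuclideanSpace ℝ (Fin d) → ℝ → ℝ} (hX : IsCenteredStationaryGaussianField P X C)
    (z w : SpaceTime d) :
    P.map (fun ω => X z ω - X w ω) = gaussianReal 0 (variogram C z w).toNNReal ∧
      0 ≤ variogram C z w := by
  have h2 : ∀ u, MemLp (X u) 2 P := fun u => (hX.gaussian.hasGaussianLaw_eval u).memLp_two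
  have hi : ∀ u, Integrable (X u) P := fun u => (h2 u).integrable (by norm_num)
  have hmean : ∫ ω, X z ω - X w ω ∂P = 0 := by
    rw [integral_sub (hi z) (hi w), hX.centered, hX.centered, sub_zero]
  have hm : ∀ u v, Integrable (fun ω => X u ω * X v ω) P := fun u v => (h2 u).integrable_mul (h2 v)
  have hvar : Var[fun ω => X z ω - X w ω; P] = variogram C z w := by
    rw [variance_of_integral_eq_zero (by have := (hi z).sub (hi w); exact this.aemeasurable) hmean]
    have e : ∀ ω, (X z ω - X w ω) ^ 2 = X z ω * X z ω + X w ω * X w ω - 2 * (X z ω * X w ω) :=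
      fun ω => by ring
    simp_rw [e]
    have hs : Integrable (fun ω => X z ω * X z ω + X w ω * X w ω) P := (hm z z).add (hm w w)
    rw [integral_sub hs ((hm z w).const_mul 2),
      integral_add (hm z z) (hm w w), integral_const_mul, hX.covariance, hX.covariance,
      hX.covariance, variogram]
    simp only [sub_self]
    ring
  refine ⟨?_, hvar ▸ variance_nonneg _ _⟩
  rw [(hX.gaussian.hasGaussianLaw_fun_sub (s := z) (t := w)).map_eq_gaussianReal, hmean, hvar]

/-- Independent copies of a stationary Gaussian field with almost surely continuous sample
functions have an indistinguishable version with continuous sample functions. -/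
theorem AreIndependentCopies.exists_continuous_version {d p : ℕ} {Ω Ω' : Type*}
    [MeasurableSpace Ω] [MeasurableSpace Ω'] {P : Measure Ω} [IsProbabilityMeasure P]
    {P' : Measure Ω'} [IsProbabilityMeasure P'] {X : SpaceTime d → Ω → ℝ}
    {Y : Fin p → SpaceTime d → Ω' → ℝ} {C : EuclideanSpace ℝ (Fin d) → ℝ → ℝ}
    (hY : AreIndependentCopies P X P' Y) (hX : IsCenteredStationaryGaussianField P X C)
    (hcont : ∀ᵐ ω ∂P', Continuous (samplePath Y ω)) :
    ∃ Y' : Fin p → SpaceTime d → Ω' → ℝ, HasIndepGaussianIncrements P' Y' (variogram C) ∧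
      ∀ᵐ ω ∂P', samplePath Y ω = samplePath Y' ω := by
  classical
  -- The set of discontinuous outcomes need not be measurable, so the field is set to 0 on a
  -- measurable null set containing it.
  obtain ⟨S, hS, hSm, hS0⟩ := exists_measurable_superset_of_null (ae_iff.1 hcont)
  set Y' : Fin p → SpaceTime d → Ω' → ℝ := fun i z ω => if ω ∈ S then 0 else Y i z ω with hY'
  have hSae : ∀ᵐ ω ∂P', ω ∉ S := measure_eq_zero_iff_ae_notMem.1 hS0
  have heq : ∀ i z w, (fun ω => Y i z ω - Y i w ω) =ᵐ[P'] fun ω => Y' i z ω - Y' i w ω :=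
    fun i z w => hSae.mono fun ω hω => by simp [hY', hω]
  refine ⟨Y', ⟨fun i z => ?_, fun i ω => ?_, fun i z w => ?_, fun z w => ?_, fun z w =>
    (hX.map_sub z w).2⟩, ?_⟩
  · exact Measurable.ite hSm measurable_const (hY.measurable i z)
  · by_cases hω : ω ∈ S
    · simp only [hY', hω, if_true]; exact continuous_const
    · simp only [hY', hω, if_false]
      have hc : Continuous (samplePath Y ω) := by
        by_contra hcon
        exact hω (hS hcon)
      exact (EuclideanSpace.proj (𝕜 := ℝ) i).continuous.comp hc
  · rw [← Measure.map_congr (heq i z w)]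
    have := (hY.identDistrib i).comp
      (u := fun f : SpaceTime d → ℝ => f z - f w) (by fun_prop)
    exact this.map_eq.trans (hX.map_sub z w).1
  · have h := hY.indep.comp (fun _ (f : SpaceTime d → ℝ) => f z - f w) fun _ => by fun_prop
    exact h.congr fun i => heq i z w
  · filter_upwards [hSae] with ω hω
    funext z
    simp only [samplePath, hY', hω, if_false]

theorem norm_sub_le_of_mem_unitCube {d : ℕ} {z w : SpaceTime d} (hz : z ∈ unitCube d)
    (hw : w ∈ unitCube d) : ‖z.1 - w.1‖ ≤ d ∧ |z.2 - w.2| ≤ 1 := by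
  have key : ∀ {x y : ℝ}, x ∈ Set.Icc (0 : ℝ) 1 → y ∈ Set.Icc (0 : ℝ) 1 → |x - y| ≤ 1 :=
    fun hx hy => abs_le.2 ⟨by linarith [hx.1, hy.2], by linarith [hx.2, hy.1]⟩
  refine ⟨?_, key hz.2 hw.2⟩
  simpa using EuclideanSpace.norm_le_mul_of_forall_abs_le zero_le_one
    fun i => by simpa using key (hz.1 i) (hw.1 i)

/-! ### Choice of exponents and the theorem. -/

/-- Upper bound for the dimension of the graph, with the mesh sizes given as `2 ^ (-u n)` in space,
`2 ^ (-v n)` in time and `2 ^ (-x n)` for the covering sets. -/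
theorem HasIndepGaussianIncrements.ae_dimH_graph_le_of_exponents {d p : ℕ} {Ω : Type*}
    [MeasurableSpace Ω] {P : Measure Ω} {Y : Fin p → SpaceTime d → Ω → ℝ}
    {V : SpaceTime d → SpaceTime d → ℝ} (hY : HasIndepGaussianIncrements P Y V) {α γ L : ℝ}
    (hα : 0 < α) (hγ : 0 < γ) (hL : 0 ≤ L)
    (hV : ∀ z w, V z w ≤ L * (‖z.1 - w.1‖ ^ (2 * γ) + |z.2 - w.2| ^ (2 * α)))
    {u v x B : ℝ} (hx : 1 ≤ x) (hxu : x ≤ u) (hxv : x ≤ v) (hu : 1 ≤ u * γ) (hv : 1 ≤ v * α)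
    (hB : u * d + v + (x - 1) * p ≤ x * B) :
    ∀ᵐ ω ∂P, dimH (graphOver (samplePath Y ω) (unitCube d)) ≤ ENNReal.ofReal B := by
  refine ae_le_ofReal_of_forall_gt fun s hs => ?_
  have hle : ∀ {y : ℝ}, 1 ≤ y → (2 : ℝ) ≤ 2 ^ y := fun hy => by
    simpa using Real.rpow_le_rpow_of_exponent_le (by norm_num : (1 : ℝ) ≤ 2) hy
  have hs0 : 0 ≤ s := by
    by_contra! hneg
    have h1 : 0 ≤ u * d := by have : 0 ≤ u := by linarith
                              positivity
    have h2 : 0 ≤ (x - 1) * p := by have : 0 ≤ x - 1 := by linarith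
                                    positivity
    nlinarith
  refine hY.ae_dimH_graph_le hα hγ hL hV (a := 2 ^ u) (b := 2 ^ v) (κ := 2 ^ x) (hle hx)
    (Real.rpow_le_rpow_of_exponent_le (by norm_num) hxu)
    (Real.rpow_le_rpow_of_exponent_le (by norm_num) hxv) ?_ ?_ hs0 ?_
  · rw [← Real.rpow_mul (by norm_num)]; exact hle hu
  · rw [← Real.rpow_mul (by norm_num)]; exact hle hv
  · have h1 : ((2 : ℝ) ^ x / 2) = 2 ^ (x - 1) := by
      rw [Real.rpow_sub (by norm_num), Real.rpow_one]
    rw [h1, ← Real.rpow_natCast, ← Real.rpow_natCast, ← Real.rpow_mul (by norm_num),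
      ← Real.rpow_mul (by norm_num), ← Real.rpow_mul (by norm_num),
      ← Real.rpow_add (by norm_num), ← Real.rpow_add (by norm_num)]
    refine Real.rpow_lt_rpow_of_exponent_lt (by norm_num) ?_
    nlinarith

theorem dimH_image_le_dimH_graphOver {T E : Type*} [MetricSpace T] [MetricSpace E] (f : T → E)
    (S : Set T) : dimH (f '' S) ≤ dimH (graphOver f S) := by
  have h : f '' S = Prod.snd '' graphOver f S := by
    rw [graphOver, Set.image_image]
  rw [h]
  exact LipschitzWith.prod_snd.dimH_image_le _

theorem ae_eq_of_ae_le_of_ae_ge {Ω : Type*} [MeasurableSpace Ω] {P : Measure Ω} {f : Ω → ℝ≥0∞}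
    {B : ℝ≥0∞} (h1 : ∀ᵐ ω ∂P, f ω ≤ B) (h2 : ∀ᵐ ω ∂P, B ≤ f ω) : ∀ᵐ ω ∂P, f ω = B := by
  filter_upwards [h1, h2] with ω h1 h2 using le_antisymm h1 h2

theorem proposition6p2 {Ω Ω' : Type*} [MeasurableSpace Ω] [MeasurableSpace Ω']
    (P : Measure Ω) [IsProbabilityMeasure P] (P' : Measure Ω') [IsProbabilityMeasure P']
    (d N p : ℕ) (hd : 1 ≤ d) (hN : 1 ≤ N) (hp : 1 ≤ p)
    (σ a c α β γ : ℝ) (hσ : 0 < σ) (ha : 0 < a) (hc : 0 < c)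
    (hα : α ∈ Set.Ioc (0 : ℝ) 1) (hβ : β ∈ Set.Ioc (0 : ℝ) 1) (hγ : γ ∈ Set.Ioc (0 : ℝ) 1)
    (X : SpaceTime d → Ω → ℝ)
    (hX : IsCenteredStationaryGaussianField P X (gneitingCov d N σ a c α β γ))
    (Y : Fin p → SpaceTime d → Ω' → ℝ) (hY : AreIndependentCopies P X P' Y)
    (hcont : ∀ᵐ ω ∂P', Continuous (samplePath Y ω)) :
    (∀ᵐ ω ∂P', dimH (samplePath Y ω '' unitCube d) =
      ENNReal.ofReal (min (p : ℝ) (d / γ + 1 / α))) ∧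
    (α ≤ γ → γ < 1 → ∀ᵐ ω ∂P', dimH (graphOver (samplePath Y ω) (unitCube d)) =
      ENNReal.ofReal
        (if (p : ℝ) < 1 / α then d + 1 + (1 - α) * p
         else if (p : ℝ) < 1 / α + d / γ then d + γ / α + (1 - γ) * p
         else 1 / α + d / γ)) ∧
    (γ ≤ α → α < 1 → ∀ᵐ ω ∂P', dimH (graphOver (samplePath Y ω) (unitCube d)) =
      ENNReal.ofReal
        (if (p : ℝ) < d / γ then d + 1 + (1 - γ) * p
         else if (p : ℝ) < 1 / α + d / γ then d * α / γ + 1 + (1 - α) * p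
         else 1 / α + d / γ)) := by
  obtain ⟨hα0, hα1⟩ := hα
  obtain ⟨hβ0, hβ1⟩ := hβ
  obtain ⟨hγ0, hγ1⟩ := hγ
  obtain ⟨Y', hY', heq⟩ := hY.exists_continuous_version hX hcont
  have hd' : (1 : ℝ) ≤ d := by exact_mod_cast hd
  have hp' : (1 : ℝ) ≤ p := by exact_mod_cast hp
  obtain ⟨L, hL0, hL⟩ := gneitingCov_increment_le (d := d) (N := N) (σ := σ) hα0 hβ0 hγ0 ha hc
  obtain ⟨k, hk0, hk⟩ := le_gneitingCov_increment (d := d) (N := N) hα0 hβ0 hγ0 ha hc hσ hN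
    (R := d) (by positivity)
  have hV : ∀ z w, variogram (gneitingCov d N σ a c α β γ) z w ≤
      (2 * L) * (‖z.1 - w.1‖ ^ (2 * γ) + |z.2 - w.2| ^ (2 * α)) := fun z w => by
    have := hL (z.1 - w.1) (z.2 - w.2)
    rw [variogram]; linarith
  have hpos : ∀ (q e : ℝ), 0 ≤ q → 0 ≤ k * q ^ e := fun q e hq => by positivity
  have hVx : ∀ z ∈ unitCube d, ∀ w ∈ unitCube d, k * ‖z.1 - w.1‖ ^ (2 * γ) ≤
      variogram (gneitingCov d N σ a c α β γ) z w := fun z hz w hw => by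
    obtain ⟨h1, h2⟩ := norm_sub_le_of_mem_unitCube hz hw
    have h3 := (hk _ _ h1 h2).1
    have h4 := hpos ‖z.1 - w.1‖ (2 * γ) (norm_nonneg _)
    rw [variogram]; linarith
  have hVt : ∀ z ∈ unitCube d, ∀ w ∈ unitCube d, k * |z.2 - w.2| ^ (2 * α) ≤
      variogram (gneitingCov d N σ a c α β γ) z w := fun z hz w hw => by
    obtain ⟨h1, h2⟩ := norm_sub_le_of_mem_unitCube hz hw
    have h3 := (hk _ _ h1 h2).2
    have h4 := hpos |z.2 - w.2| (2 * α) (abs_nonneg _)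
    rw [variogram]; linarith
  have transfer : ∀ (D : ℝ) (F : (SpaceTime d → EuclideanSpace ℝ (Fin p)) → ℝ≥0∞),
      (∀ᵐ ω ∂P', F (samplePath Y' ω) = ENNReal.ofReal D) →
      ∀ᵐ ω ∂P', F (samplePath Y ω) = ENNReal.ofReal D := fun D F h => by
    filter_upwards [h, heq] with ω h1 h2
    rw [h2, h1]
  have upper := fun {u v x B : ℝ} => hY'.ae_dimH_graph_le_of_exponents (u := u) (v := v) (x := x)
    (B := B) hα0 hγ0 (mul_nonneg zero_le_two hL0) hV
  have lower := fun {a₁ a₂ b₁ b₂ : ℝ} => hY'.ae_le_dimH_graph (a₁ := a₁) (a₂ := a₂) (b₁ := b₁)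
    (b₂ := b₂) hd hp hα0 hγ0 hα1 hγ1 hk0 hVx hVt
  have lower' := fun {a₁ a₂ : ℝ} => hY'.ae_le_dimH_image (a₁ := a₁) (a₂ := a₂)
    hd hp hα0 hγ0 hα1 hγ1 hk0 hVx hVt
  have hγi : 1 ≤ 1 / γ := by rwa [one_le_div hγ0]
  have hαi : 1 ≤ 1 / α := by rwa [one_le_div hα0]
  have hγγ : 1 / γ * γ = 1 := by field_simp
  have hαα : 1 / α * α = 1 := by field_simp
  have hγd : γ * (d / γ) = d := by field_simp
  have hα1' : α * (1 / α) = 1 := by field_simp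
  have hdγ0 : 0 < d / γ := by positivity
  -- With x = 1 the covering sets have the size of the oscillation, so the factor in p disappears.
  have upperQ : ∀ᵐ ω ∂P', dimH (graphOver (samplePath Y' ω) (unitCube d)) ≤
      ENNReal.ofReal (1 / α + d / γ) :=
    upper (u := 1 / γ) (v := 1 / α) (x := 1) le_rfl hγi hαi hγγ.ge hαα.ge
      (le_of_eq (by ring))
  have lowerQ : 1 / α + d / γ ≤ p → ∀ᵐ ω ∂P', ENNReal.ofReal (1 / α + d / γ) ≤
      dimH (graphOver (samplePath Y' ω) (unitCube d)) := fun h => by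
    have := lower (a₁ := d / γ) (a₂ := 1 / α) (b₁ := 0) (b₂ := 0) hdγ0.le (by positivity) le_rfl
      le_rfl (by linarith) (by linarith) (by linarith)
    rwa [show d / γ + 1 / α + 0 + 0 = 1 / α + d / γ by ring] at this
  refine ⟨?_, fun hαγ hγlt => ?_, fun hγα hαlt => ?_⟩
  · refine transfer _ (fun f => dimH (f '' unitCube d)) (ae_eq_of_ae_le_of_ae_ge ?_ ?_)
    · filter_upwards [upperQ] with ω hω
      rw [ENNReal.ofReal_min]
      refine le_min ?_ ?_
      · refine (dimH_mono (Set.subset_univ _)).trans ?_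
        rw [Real.dimH_univ_eq_finrank]
        simp
      · rw [add_comm]
        exact (dimH_image_le_dimH_graphOver _ _).trans hω
    · set Q := d / γ + 1 / α with hQ
      have hQ0 : 0 < Q := by positivity
      -- The exponents (d/γ, 1/α) exhaust space and time; scaling them by `lam` brings their sum
      -- down to min(p, Q).
      set lam := min (p : ℝ) Q / Q with hlam
      have hlam0 : 0 ≤ lam := by positivity
      have hlam1 : lam ≤ 1 := by rw [hlam, div_le_one hQ0]; exact min_le_right _ _
      have hlamQ : lam * (d / γ) + lam * (1 / α) = min (p : ℝ) Q := by
        rw [← mul_add, ← hQ, hlam, div_mul_cancel₀ _ hQ0.ne']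
      have := lower' (a₁ := lam * (d / γ)) (a₂ := lam * (1 / α)) (by positivity) (by positivity)
        (by rw [mul_left_comm, hγd]; nlinarith) (by rw [mul_left_comm, hα1']; linarith)
        (by rw [hlamQ]; exact min_le_left _ _)
      rwa [hlamQ] at this
  · refine transfer _ (fun f => dimH (graphOver f (unitCube d))) ?_
    have hle : 1 / γ ≤ 1 / α := one_div_le_one_div_of_le hα0 hαγ
    split_ifs with h1 h2
    · have hαp : α * p < 1 := by rwa [lt_div_iff₀ hα0, mul_comm] at h1
      refine ae_eq_of_ae_le_of_ae_ge ?_ ?_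
      · refine upper (u := 1 / α) (v := 1 / α) (x := 1 / α) hαi le_rfl le_rfl ?_ hαα.ge (le_of_eq ?_)
        · exact hγγ.ge.trans (by gcongr)
        · field_simp
      -- As αp < 1, time alone pays for the increment exponent p; what is left of time and all of
      -- space go to the displacement.
      · have := lower (a₁ := 0) (a₂ := p) (b₁ := d) (b₂ := 1 - α * p) le_rfl (by positivity)
          (by positivity) (by linarith) (by linarith) (by linarith) (by linarith)
        rwa [show 0 + (p : ℝ) + d + (1 - α * p) = d + 1 + (1 - α) * p by ring] at this
    · push Not at h1
      refine ae_eq_of_ae_le_of_ae_ge ?_ ?_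
      · refine upper (u := 1 / γ) (v := 1 / α) (x := 1 / γ) hγi le_rfl hle hγγ.ge hαα.ge (le_of_eq ?_)
        field_simp
      · have h3 : γ * (p - 1 / α) ≤ d := by rw [← hγd]; gcongr; linarith
        -- Time is exhausted at 1/α; space pays for the rest of p and keeps the remainder for the
        -- displacement.
        have := lower (a₁ := p - 1 / α) (a₂ := 1 / α) (b₁ := d - γ * (p - 1 / α)) (b₂ := 0)
          (by linarith) (by positivity) (by linarith) le_rfl (by linarith) (by linarith)
          (by linarith)
        rwa [show p - 1 / α + 1 / α + (d - γ * (p - 1 / α)) + 0 = d + γ / α + (1 - γ) * p by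
          ring] at this
    · exact ae_eq_of_ae_le_of_ae_ge upperQ (lowerQ (not_lt.1 h2))
  · refine transfer _ (fun f => dimH (graphOver f (unitCube d))) ?_
    have hle : 1 / α ≤ 1 / γ := one_div_le_one_div_of_le hγ0 hγα
    split_ifs with h1 h2
    · have hγp : γ * p < d := by rwa [lt_div_iff₀ hγ0, mul_comm] at h1
      refine ae_eq_of_ae_le_of_ae_ge ?_ ?_
      · refine upper (u := 1 / γ) (v := 1 / γ) (x := 1 / γ) hγi le_rfl le_rfl hγγ.ge ?_ (le_of_eq ?_)
        · exact hαα.ge.trans (by gcongr)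
        · field_simp
      -- Now space is the cheaper direction and pays for all of p.
      · have := lower (a₁ := p) (a₂ := 0) (b₁ := d - γ * p) (b₂ := 1) (by positivity) le_rfl
          (by linarith) zero_le_one (by linarith) (by linarith) (by linarith)
        rwa [show (p : ℝ) + 0 + (d - γ * p) + 1 = d + 1 + (1 - γ) * p by ring] at this
    · push Not at h1
      refine ae_eq_of_ae_le_of_ae_ge ?_ ?_
      · refine upper (u := 1 / γ) (v := 1 / α) (x := 1 / α) hαi hle le_rfl hγγ.ge hαα.ge (le_of_eq ?_)
        field_simp
      · have h3 : α * (p - d / γ) ≤ 1 := by rw [← hα1']; gcongr; linarith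
        -- Space is exhausted at d/γ; time pays for the rest of p.
        have := lower (a₁ := d / γ) (a₂ := p - d / γ) (b₁ := 0) (b₂ := 1 - α * (p - d / γ))
          hdγ0.le (by linarith) le_rfl (by linarith) (by linarith) (by linarith) (by linarith)
        rwa [show d / γ + (p - d / γ) + 0 + (1 - α * (p - d / γ)) =
          d * α / γ + 1 + (1 - α) * p by ring] at this
    · exact ae_eq_of_ae_le_of_ae_ge upperQ (lowerQ (not_lt.1 h2))
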